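/- Let $K$ be an algebraically closed field, $\Lambda$ a finite dimensional (associative, unital) $K$-algebra, $e\in\Lambda$ a primitive idempotent, and $A:=\Lambda^{\rm op}\otimes_K\Lambda$ the enveloping algebra. Then there is a $K$-linear automorphism $\varsigma$ of $A$ with $\varsigma(xy)=\varsigma(y)\varsigma(x)$ for all $x,y\in A$ (an anti-automorphism) such that $\varsigma(a\otimes b)=b\otimes a$ for all $a,b\in\Lambda$; the element $e\otimes e$ is a primitive idempotent of $A$, and $\varsigma(e\otimes e)=e\otimes e$. Moreover, for the projective right $A$-module $P:=(e\otimes e)A$ there is an order-reversing bijection (an anti-isomorphism of posets) $$\mathcal{T}_P^-\;\stackrel{\rm anti}{\simeq}\;\mathcal{T}_P^+ .$$ Here $\mathcal{K}_A:=\mathsf{K}^{\rm b}(\mathsf{proj}\,A)$ is the bounded homotopy category of finitely generated projective right $A$-modules. For objects $T,U$ of $\mathcal{K}_A$ write $T\geq U$ if $\operatorname{Hom}_{\mathcal{K}_A}(T,U[i])=0$ for all $i>0$. An object $T$ is silting if $T\geq T$ and the smallest thick subcategory of $\mathcal{K}_A$ containing $T$ is $\mathcal{K}_A$; it is basic if it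 is a finite direct sum of pairwise non-isomorphic indecomposable objects. Let $\mathsf{silt}\,A$ be the set of isomorphism classes of basic silting objects, ordered by $\geq$, and $\mathsf{2silt}\,A:=\{T\in\mathsf{silt}\,A \mid A\geq T\geq A[1]\}$. If $T= X\oplus M$, the left mutation $\mu_X^-(T)$ is $Y\oplus M$, where $X\xrightarrow{f} M'\to Y\to X[1]$ is a triangle and $f$ is a minimal left $\mathsf{add}\,M$-approximation of $X$; dually, the right mutation $\mu_X^+(T)$ is $Y\oplus M$, where $Y\to M'\xrightarrow{f} X\to Y[1]$ is a triangle and $f$ is a minimal right $\mathsf{add}\,M$-approximation of $X$. Let $A_{\rm b}$ be the basic direct summand of $A$ in $\mathcal{K}_A$ with $\mathsf{add}\,A_{\rm b}=\mathsf{add}\,A$ (so $A_{\rm b}=A$ if $A$ is basic). Then $$\mathcal{T}_P^-:=\{T\in\mathsf{2silt}\,A\mid \mu_P^-(A_{\rm b})\geq T\geq A[1]\},\qquad \mathcal{T}_P^+:=\{T\in\mathsf{2silt}\,A\mid A\geq T\geq \mu_{P[1]}^+(A_{\rm b}[1])\}.$$ -/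

import Mathlib

open CategoryTheory CategoryTheory.Limits CategoryTheory.Pretriangulated ZeroObject
open scoped TensorProduct

noncomputable section

/-! ### Primitive idempotents -/

/-- A primitive idempotent: a nonzero idempotent that is not the sum of two nonzero orthogonal
idempotents. -/
structure IsPrimitiveIdempotent {R : Type*} [Ring R] (e : R) : Prop where
  idem : IsIdempotentElem e
  ne_zero : e ≠ 0
  eq_zero_or_eq_zero : ∀ f g : R, IsIdempotentElem f → IsIdempotentElem g →
    f * g = 0 → g * f = 0 → e = f + g → f = 0 ∨ g = 0

/-! ### Silting theory in a triangulated category -/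

namespace Silting

section Order

universe w' w

variable {C : Type w} [Category.{w'} C] [Preadditive C] [HasShift C ℤ]

/-- `T ≥ U`, that is, `Hom(T, U[i]) = 0` for all `i > 0`. -/
def GE (T U : C) : Prop := ∀ i : ℤ, 0 < i → ∀ f : T ⟶ U⟦i⟧, f = 0

lemma GE.of_iso {T T' U U' : C} (a : T ≅ T') (b : U ≅ U') (h : GE T U) : GE T' U' := by
  intro i hi f
  have h0 := h i hi (a.hom ≫ f ≫ (b.inv)⟦i⟧')
  have h1 : f = a.inv ≫ (a.hom ≫ f ≫ (b.inv)⟦i⟧') ≫ (b.hom)⟦i⟧' := by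
    simp [← Functor.map_comp]
  rw [h1, h0]
  simp

end Order

section Triangulated

universe w' w

variable {C : Type w} [Category.{w'} C] [Preadditive C] [HasZeroObject C] [HasShift C ℤ]
  [∀ n : ℤ, (shiftFunctor C n).Additive] [Pretriangulated C]

/-- The smallest thick subcategory (triangulated, closed under direct summands) containing `T`,
as a property of objects. -/
def thick (T : C) : ObjectProperty C := fun X =>
  ∀ Q : ObjectProperty C, Q.IsTriangulated → Q.IsStableUnderRetracts → Q T → Q X

/-- Silting objects. -/
structure IsSilting (T : C) : Prop where
  hom_eq_zero : ∀ i : ℤ, 0 < i → ∀ f : T ⟶ T⟦i⟧, f = 0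
  thick_eq_top : thick T = ⊤

/-- Basic objects: finite direct sums of pairwise non-isomorphic indecomposable objects. -/
def IsBasic (T : C) : Prop :=
  ∃ (n : ℕ) (X : Fin n → C), (∀ i, Indecomposable (X i)) ∧
    (∀ i j, i ≠ j → IsEmpty (X i ≅ X j)) ∧ Nonempty (T ≅ ⨁ X)

/-- `add M`: the direct summands of finite direct sums of copies of `M`. -/
def add (M : C) : ObjectProperty C := fun X =>
  ∃ (n : ℕ) (Z : C), Nonempty ((⨁ fun _ : Fin n => M) ≅ X ⊞ Z)

/-- `f : X ⟶ M'` is a minimal left `add M`-approximation of `X`. -/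
structure IsMinimalLeftApprox (M : C) {X M' : C} (f : X ⟶ M') : Prop where
  mem_add : add M M'
  factors : ∀ (N : C), add M N → ∀ g : X ⟶ N, ∃ h : M' ⟶ N, f ≫ h = g
  minimal : ∀ h : M' ⟶ M', f ≫ h = f → IsIso h

/-- `f : M' ⟶ X` is a minimal right `add M`-approximation of `X`. -/
structure IsMinimalRightApprox (M : C) {X M' : C} (f : M' ⟶ X) : Prop where
  mem_add : add M M'
  factors : ∀ (N : C), add M N → ∀ g : N ⟶ X, ∃ h : N ⟶ M', h ≫ f = g
  minimal : ∀ h : M' ⟶ M', h ≫ f = f → IsIso h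

/-- `U` is (isomorphic to) the left mutation `μ_X^-(T)`: there are a decomposition `T ≅ X ⊞ M` and
a triangle `X ⟶ M' ⟶ Y ⟶ X⟦1⟧` whose first map is a minimal left `add M`-approximation,
with `U ≅ Y ⊞ M`. -/
def IsLeftMutation (T X U : C) : Prop :=
  ∃ (M M' Y : C) (f : X ⟶ M') (g : M' ⟶ Y) (h : Y ⟶ X⟦(1 : ℤ)⟧),
    Nonempty (T ≅ X ⊞ M) ∧ IsMinimalLeftApprox M f ∧
    Triangle.mk f g h ∈ distTriang C ∧ Nonempty (U ≅ Y ⊞ M)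

/-- `U` is (isomorphic to) the right mutation `μ_X^+(T)`: there are a decomposition `T ≅ X ⊞ M` and
a triangle `Y ⟶ M' ⟶ X ⟶ Y⟦1⟧` whose second map is a minimal right `add M`-approximation,
with `U ≅ Y ⊞ M`. -/
def IsRightMutation (T X U : C) : Prop :=
  ∃ (M M' Y : C) (g : Y ⟶ M') (f : M' ⟶ X) (h : X ⟶ Y⟦(1 : ℤ)⟧),
    Nonempty (T ≅ X ⊞ M) ∧ IsMinimalRightApprox M f ∧
    Triangle.mk g f h ∈ distTriang C ∧ Nonempty (U ≅ Y ⊞ M)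

variable (C) in
/-- The type of basic silting objects. -/
def BasicSilting : Type w := {T : C // IsSilting T ∧ IsBasic T}

variable (C) in
/-- Isomorphism of basic silting objects. -/
instance basicSiltingSetoid : Setoid (BasicSilting C) where
  r T U := Nonempty (T.1 ≅ U.1)
  iseqv :=
    { refl := fun T => ⟨Iso.refl T.1⟩
      symm := fun ⟨e⟩ => ⟨e.symm⟩
      trans := fun ⟨e⟩ ⟨e'⟩ => ⟨e.trans e'⟩ }

variable (C) in
/-- The set of isomorphism classes of basic silting objects. -/
def Silt : Type w := Quotient (basicSiltingSetoid C)

/-- The relation on isomorphism classes of basic silting objects, `U ≤ T` meaning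
`Hom(T, U[i]) = 0` for all `i > 0`. -/
instance : LE (Silt C) where
  le := Quotient.lift₂ (fun U T : BasicSilting C => GE T.1 U.1) (by
    rintro U T U' T' ⟨u⟩ ⟨t⟩
    exact propext ⟨GE.of_iso t u, GE.of_iso t.symm u.symm⟩)

/-- For an object `L` (to be the algebra, as a stalk complex in degree `0`), the classes of basic
silting objects `T` with `L ≥ T ≥ L[1]`. -/
def twoSilt (L : C) : Set (Silt C) :=
  {t | ∃ T : BasicSilting C, Quotient.mk _ T = t ∧ GE L T.1 ∧ GE T.1 (L⟦(1 : ℤ)⟧)}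

/-- `B` is a basic version of `L`, that is, `B` is basic and `add B = add L`. -/
def IsBasicVersion (B L : C) : Prop := IsBasic B ∧ add B = add L

/-- `𝒯_P^-`: the classes in `twoSilt L` of those `T` with `μ_P^-(L) ≥ T ≥ L[1]`. The mutation is
that of the basic silting object `B` with `add B = add L`. -/
def TMinus (L P : C) : Set (Silt C) :=
  {t | t ∈ twoSilt L ∧ ∃ T : BasicSilting C, Quotient.mk _ T = t ∧
    ∃ B U : C, IsBasicVersion B L ∧ IsLeftMutation B P U ∧
      GE U T.1 ∧ GE T.1 (L⟦(1 : ℤ)⟧)}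

/-- `𝒯_P^+`: the classes in `twoSilt L` of those `T` with `L ≥ T ≥ μ_{P[1]}^+(L[1])`. The mutation
is that of the basic silting object `B` with `add B = add L[1]`. -/
def TPlus (L P : C) : Set (Silt C) :=
  {t | t ∈ twoSilt L ∧ ∃ T : BasicSilting C, Quotient.mk _ T = t ∧
    ∃ B U : C, IsBasicVersion B (L⟦(1 : ℤ)⟧) ∧ IsRightMutation B (P⟦(1 : ℤ)⟧) U ∧
      GE L T.1 ∧ GE T.1 U}

end Triangulated

/-! ### The bounded homotopy category of an additive category -/

section Bounded

universe w' w

variable (D : Type w) [Category.{w'} D] [Preadditive D]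

/-- The objects of the homotopy category whose underlying complex is bounded. -/
def bounded : ObjectProperty (HomotopyCategory D (ComplexShape.up ℤ)) := fun X =>
  ∃ a b : ℤ, CochainComplex.IsStrictlyGE X.as a ∧ CochainComplex.IsStrictlyLE X.as b

variable {D}

lemma bounded_quotient_obj (K : CochainComplex D ℤ) (a b : ℤ) (ha : K.IsStrictlyGE a)
    (hb : K.IsStrictlyLE b) :
    bounded D ((HomotopyCategory.quotient D (ComplexShape.up ℤ)).obj K) :=
  ⟨a, b, ha, hb⟩

instance [HasZeroObject D] : (bounded D).ContainsZero where
  exists_zero := by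
    have hz : IsZero ((CochainComplex.singleFunctor D 0).obj (0 : D)) :=
      Functor.map_isZero _ (isZero_zero D)
    exact ⟨(HomotopyCategory.quotient D (ComplexShape.up ℤ)).obj _,
      Functor.map_isZero _ hz, bounded_quotient_obj _ 0 0 inferInstance inferInstance⟩

instance : (bounded D).IsStableUnderShift ℤ where
  isStableUnderShiftBy n :=
    { le_shift := fun K hK => by
        obtain ⟨K : CochainComplex D ℤ, rfl⟩ := K.quotient_obj_surjective
        obtain ⟨a, b, ha, hb⟩ := hK
        replace ha : K.IsStrictlyGE a := ha
        replace hb : K.IsStrictlyLE b := hb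
        rw [ObjectProperty.prop_shift_iff, HomotopyCategory.shift_quotient_obj]
        exact bounded_quotient_obj _ (a - n) (b - n)
          (K.isStrictlyGE_shift a n (a - n) (by lia))
          (K.isStrictlyLE_shift b n (b - n) (by lia)) }

lemma isStrictlyLE_mappingCone [HasBinaryBiproducts D] {K L : CochainComplex D ℤ} (f : K ⟶ L)
    (n₁ n₂ n : ℤ) [K.IsStrictlyLE n₁] [L.IsStrictlyLE n₂] (hn₁ : n₁ ≤ n) (hn₂ : n₂ ≤ n) :
    (CochainComplex.mappingCone f).IsStrictlyLE n := by
  rw [CochainComplex.isStrictlyLE_iff]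
  intro i hi
  simp only [CochainComplex.mappingCone.isZero_X_iff]
  exact ⟨K.isZero_of_isStrictlyLE n₁ _ (by lia), L.isZero_of_isStrictlyLE n₂ _ (by lia)⟩

instance [HasZeroObject D] [HasBinaryBiproducts D] : (bounded D).IsTriangulatedClosed₃ where
  ext₃' T hT h₁ h₂ := by
    obtain ⟨a₁, b₁, _, _⟩ := h₁
    obtain ⟨a₂, b₂, _, _⟩ := h₂
    obtain ⟨f : T.obj₁.as ⟶ T.obj₂.as, hf⟩ :=
      (HomotopyCategory.quotient D (ComplexShape.up ℤ)).map_surjective T.mor₁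
    refine ⟨_, ?_,
      ⟨Triangle.π₃.mapIso (isoTriangleOfIso₁₂ T _ hT
        (HomotopyCategory.mappingCone_triangleh_distinguished f)
        (Iso.refl _) (Iso.refl _) ?_)⟩⟩
    · exact bounded_quotient_obj _ (min (a₁ - 1) a₂) (max b₁ b₂)
        (CochainComplex.isStrictlyGE_mappingCone f a₁ a₂ _ (by lia) (by lia))
        (isStrictlyLE_mappingCone f b₁ b₂ _ (by lia) (by lia))
    · exact (Category.comp_id _).trans (hf.symm.trans (Category.id_comp _).symm)

instance [HasZeroObject D] [HasBinaryBiproducts D] : (bounded D).IsTriangulated where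
  toIsTriangulatedClosed₂ := .of_isTriangulatedClosed₃

variable (D) in
/-- The bounded homotopy category. -/
abbrev Kb := (bounded D).FullSubcategory

/-- The stalk complex concentrated in degree `0`. -/
def stalk [HasZeroObject D] (X : D) : Kb D :=
  ⟨(HomotopyCategory.quotient D (ComplexShape.up ℤ)).obj
      ((CochainComplex.singleFunctor D 0).obj X),
    bounded_quotient_obj _ 0 0 inferInstance inferInstance⟩

end Bounded

/-! ### Finitely generated projective right modules -/

section Modules

universe v

variable (A : Type v) [Ring A]

/-- Finitely generated projective right `A`-modules, as left modules over the opposite ring. -/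
def isProj : ObjectProperty (ModuleCat.{v} Aᵐᵒᵖ) := fun M =>
  Module.Finite Aᵐᵒᵖ M ∧ Module.Projective Aᵐᵒᵖ M

/-- The category `proj A` of finitely generated projective right `A`-modules. -/
abbrev Proj := (isProj A).FullSubcategory

instance : (isProj A).IsClosedUnderIsomorphisms where
  of_iso := by
    rintro X Y e ⟨h₁, h₂⟩
    exact ⟨Module.Finite.equiv e.toLinearEquiv, Module.Projective.of_equiv e.toLinearEquiv⟩

instance : (isProj A).ContainsZero where
  exists_zero := ⟨ModuleCat.of Aᵐᵒᵖ PUnit, ModuleCat.isZero_of_subsingleton _,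
    ⟨inferInstanceAs (Module.Finite Aᵐᵒᵖ PUnit.{v + 1}),
      inferInstanceAs (Module.Projective Aᵐᵒᵖ PUnit.{v + 1})⟩⟩

instance : (isProj A).IsClosedUnderBinaryProducts where
  limitsOfShape_le := by
    rintro X ⟨p⟩
    obtain ⟨_, _⟩ := p.prop_diag_obj ⟨WalkingPair.left⟩
    obtain ⟨_, _⟩ := p.prop_diag_obj ⟨WalkingPair.right⟩
    let M := p.diag.obj ⟨WalkingPair.left⟩
    let N := p.diag.obj ⟨WalkingPair.right⟩
    let e : X ≅ ModuleCat.of Aᵐᵒᵖ (M × N) :=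
      IsLimit.conePointsIsoOfNatIso p.isLimit (ModuleCat.binaryProductLimitCone M N).isLimit
        (diagramIsoPair p.diag)
    exact (isProj A).prop_of_iso e.symm
      ⟨inferInstanceAs (Module.Finite Aᵐᵒᵖ (M × N)),
        inferInstanceAs (Module.Projective Aᵐᵒᵖ (M × N))⟩

instance : (isProj A).IsClosedUnderFiniteProducts := .mk'

instance : HasFiniteBiproducts (Proj A) := HasFiniteBiproducts.of_hasFiniteProducts

instance : HasBinaryBiproducts (Proj A) := hasBinaryBiproducts_of_finite_biproducts _

variable {A}

variable (A) in
/-- The regular right module is free of rank one. -/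
def regularEquiv : Aᵐᵒᵖ ≃ₗ[Aᵐᵒᵖ] A where
  toFun := MulOpposite.unop
  invFun := MulOpposite.op
  map_add' _ _ := rfl
  map_smul' _ _ := rfl
  left_inv _ := rfl
  right_inv _ := rfl

lemma isProj_regular : isProj A (ModuleCat.of Aᵐᵒᵖ A) :=
  ⟨Module.Finite.equiv (regularEquiv A), Module.Projective.of_equiv (regularEquiv A)⟩

/-- The right ideal `eA`. -/
def rightIdeal (e : A) : Submodule Aᵐᵒᵖ A := Submodule.span Aᵐᵒᵖ {e}

lemma isProj_rightIdeal {e : A} (he : IsIdempotentElem e) :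
    isProj A (ModuleCat.of Aᵐᵒᵖ (rightIdeal e)) := by
  have hP : Module.Projective Aᵐᵒᵖ A := isProj_regular.2
  refine ⟨?_, ?_⟩
  · exact Module.Finite.iff_fg.2 (Submodule.fg_span_singleton e)
  · let π : A →ₗ[Aᵐᵒᵖ] rightIdeal e :=
      { toFun := fun a => ⟨e * a, Submodule.mem_span_singleton.2 ⟨MulOpposite.op a, rfl⟩⟩
        map_add' := fun a b => Subtype.ext (mul_add e a b)
        map_smul' := fun r a => Subtype.ext (mul_assoc e a r.unop).symm }
    refine Module.Projective.of_split (rightIdeal e).subtype π (LinearMap.ext ?_)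
    rintro ⟨x, hx⟩
    obtain ⟨r, rfl⟩ := Submodule.mem_span_singleton.1 hx
    refine Subtype.ext ?_
    change e * (e * r.unop) = e * r.unop
    rw [← mul_assoc, he.eq]

variable (A) in
/-- The stalk complex of the regular right module, in `K^b(proj A)`. -/
def regular : Kb (Proj A) := stalk ⟨ModuleCat.of Aᵐᵒᵖ A, isProj_regular⟩

/-- The stalk complex of the projective right module `eA`, in `K^b(proj A)`. -/
def idempotentProj {e : A} (he : IsIdempotentElem e) : Kb (Proj A) :=
  stalk ⟨ModuleCat.of Aᵐᵒᵖ (rightIdeal e), isProj_rightIdeal he⟩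

end Modules

end Silting

end

/-! The duality `Hom_A(-, A)` turns projective right modules into projective left modules, and an
anti-involution `τ` of `A` turns these back into right modules. This gives a self-duality of `proj
A` whose square is isomorphic to the identity. It fixes `A`, and it fixes `eA` as soon as `τ` fixes
`e`. Extended to complexes and followed by `[1]`, it exchanges `A` with `A[1]` and `P` with `P[1]`,
reverses `≥`, preserves silting and basic objects, and exchanges left with right approximations,
hence `μ_P^-(A_b)` with `μ_{P[1]}^+(A_b[1])`. So it swaps the two intervals. Witnesses for the
mutations are simply transported, so neither existence nor uniqueness of mutations is needed. The
carrying lemmas are `isDuality_dualKb`, `IsDuality.comp_shift` and `IsDuality.tMinusOrderIso`; for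
the enveloping algebra, `τ` is the swap of factors.

Primitivity of `e ⊗ e` uses that `K` is algebraically closed: `eΛe` is local with residue field `K`
and nilpotent radical, so the corner of `d ⊗ e` maps to that of `d` with nilpotent kernel. An
idempotent killed by this map is zero (`IsPrimitiveIdempotent.tmul`). -/

noncomputable section

namespace Silting

/-! ### Contravariant additive functors and biproducts -/

section Additive

universe w' w

variable {C : Type w} [Category.{w'} C] [Preadditive C]

/-- A contravariant additive functor sends binary biproducts to binary biproducts. -/
def mapOpBiprod [HasBinaryBiproducts C] (F : Cᵒᵖ ⥤ C) [F.Additive] (X Y : C) :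
    F.obj (.op (X ⊞ Y)) ≅ F.obj (.op X) ⊞ F.obj (.op Y) where
  hom := biprod.lift (F.map biprod.inl.op) (F.map biprod.inr.op)
  inv := biprod.desc (F.map biprod.fst.op) (F.map biprod.snd.op)
  hom_inv_id := by
    rw [biprod.lift_desc, ← F.map_comp, ← F.map_comp, ← op_comp, ← op_comp, ← F.map_add,
      ← op_add, biprod.total, op_id, F.map_id]
  inv_hom_id := by
    ext <;> simp [← F.map_comp, ← op_comp]

/-- A contravariant additive functor sends finite biproducts to finite biproducts. -/
def mapOpBiproduct [HasFiniteBiproducts C] (F : Cᵒᵖ ⥤ C) [F.Additive] {n : ℕ} (X : Fin n → C) :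
    F.obj (.op (⨁ X)) ≅ ⨁ fun i => F.obj (.op (X i)) where
  hom := biproduct.lift fun i => F.map (biproduct.ι X i).op
  inv := biproduct.desc fun i => F.map (biproduct.π X i).op
  hom_inv_id := by
    rw [biproduct.lift_desc]
    simp only [← F.map_comp, ← op_comp]
    rw [← F.map_sum, ← op_sum, biproduct.total, op_id, F.map_id]
  inv_hom_id := by
    ext i j
    by_cases h : i = j
    · subst h
      simp [← F.map_comp, ← op_comp]
    · simp [← F.map_comp, ← op_comp, biproduct.ι_π_ne _ h, biproduct.ι_π_ne _ (Ne.symm h)]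

end Additive

/-! ### Silting notions under isomorphism, and triangles up to sign -/

section Triangulated

universe w' w

variable {C : Type w} [Category.{w'} C] [Preadditive C] [HasZeroObject C] [HasShift C ℤ]
  [∀ n : ℤ, (shiftFunctor C n).Additive] [Pretriangulated C]

lemma IsSilting.of_iso {T T' : C} (a : T ≅ T') (h : IsSilting T) : IsSilting T' where
  hom_eq_zero := GE.of_iso a a h.hom_eq_zero
  thick_eq_top := by
    ext X
    simp only [Pi.top_apply, Prop.top_eq_true, iff_true]
    intro Q hQ hQ' hT
    exact (h.thick_eq_top.ge X trivial) Q hQ hQ' (Q.prop_of_iso a.symm hT)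

lemma IsBasic.of_iso {T T' : C} (a : T ≅ T') (h : IsBasic T) : IsBasic T' := by
  obtain ⟨n, X, h₁, h₂, ⟨e⟩⟩ := h
  exact ⟨n, X, h₁, h₂, ⟨a.symm ≪≫ e⟩⟩

lemma add.of_iso {M M' X X' : C} (a : M ≅ M') (b : X ≅ X') (h : add M X) : add M' X' := by
  obtain ⟨n, Z, ⟨e⟩⟩ := h
  exact ⟨n, Z, ⟨(biproduct.mapIso fun _ => a.symm) ≪≫ e ≪≫ biprod.mapIso b (Iso.refl Z)⟩⟩

lemma add_eq_of_iso {M M' : C} (a : M ≅ M') : add M = add M' := by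
  ext X
  exact ⟨add.of_iso a (Iso.refl X), add.of_iso a.symm (Iso.refl X)⟩

lemma IsLeftMutation.of_iso {T X X' U : C} (b : X ≅ X') (h : IsLeftMutation T X U) :
    IsLeftMutation T X' U := by
  obtain ⟨M, M', Y, f, g, h, ⟨e⟩, hf, hT, hU⟩ := h
  refine ⟨M, M', Y, b.inv ≫ f, g, h ≫ b.hom⟦1⟧', ⟨e ≪≫ biprod.mapIso b (Iso.refl M)⟩,
    ⟨hf.mem_add, fun N hN g => ?_, fun h hh => hf.minimal h ?_⟩,
    isomorphic_distinguished _ hT _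
      (Triangle.isoMk _ _ b.symm (Iso.refl _) (Iso.refl _) (Category.comp_id _)
        ((Category.comp_id g).trans (Category.id_comp g).symm) ?_), hU⟩
  · obtain ⟨k, hk⟩ := hf.factors N hN (b.hom ≫ g)
    exact ⟨k, by simp [hk]⟩
  · rw [← cancel_epi b.inv, ← Category.assoc, hh]
  · change (h ≫ b.hom⟦1⟧') ≫ b.inv⟦1⟧' = 𝟙 Y ≫ h
    rw [Category.assoc, ← Functor.map_comp, b.hom_inv_id, CategoryTheory.Functor.map_id,
      Category.comp_id, Category.id_comp]

lemma IsRightMutation.of_iso {T X X' U : C} (b : X ≅ X') (h : IsRightMutation T X U) :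
    IsRightMutation T X' U := by
  obtain ⟨M, M', Y, g, f, h, ⟨e⟩, hf, hT, hU⟩ := h
  refine ⟨M, M', Y, g, f ≫ b.hom, b.inv ≫ h, ⟨e ≪≫ biprod.mapIso b (Iso.refl M)⟩,
    ⟨hf.mem_add, fun N hN g => ?_, fun h hh => hf.minimal h ?_⟩,
    isomorphic_distinguished _ hT _
      (Triangle.isoMk _ _ (Iso.refl _) (Iso.refl _) b.symm
        ((Category.comp_id g).trans (Category.id_comp g).symm) ?_ ?_), hU⟩
  · obtain ⟨k, hk⟩ := hf.factors N hN (g ≫ b.inv)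
    exact ⟨k, by simp [reassoc_of% hk]⟩
  · rw [← cancel_mono b.hom, Category.assoc, hh]
  · change (f ≫ b.hom) ≫ b.inv = 𝟙 M' ≫ f
    simp
  · change (b.inv ≫ h) ≫ (𝟙 Y)⟦1⟧' = b.inv ≫ h
    simp

lemma IsBasicVersion.of_iso {B L L' : C} (a : L ≅ L') (h : IsBasicVersion B L) :
    IsBasicVersion B L' :=
  ⟨h.1, h.2.trans (add_eq_of_iso a)⟩

/-- The automorphism `-1` of the middle term absorbs both signs. -/
lemma mem_distTriang_of_neg {X Y Z : C} {f : X ⟶ Y} {g : Y ⟶ Z} {h : Z ⟶ X⟦(1 : ℤ)⟧}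
    (hT : Triangle.mk (-f) (-g) h ∈ distTriang C) : Triangle.mk f g h ∈ distTriang C := by
  let n : Y ≅ Y := ⟨-𝟙 Y, -𝟙 Y, by simp, by simp⟩
  refine isomorphic_distinguished _ hT _ (Triangle.isoMk _ _ (Iso.refl X) n (Iso.refl Z) ?_ ?_ ?_)
  · change f ≫ (-𝟙 Y) = 𝟙 X ≫ (-f)
    simp
  · change g ≫ 𝟙 Z = (-𝟙 Y) ≫ (-g)
    simp
  · change h ≫ (𝟙 X)⟦1⟧' = 𝟙 Z ≫ h
    simp

/-- Three rotations produce the shifted triangle with all signs changed. The sign of the third map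
is irrelevant, since only its existence is asked for. -/
lemma exists_mem_distTriang_shift {X Y Z : C} {f : X ⟶ Y} {g : Y ⟶ Z} {h : Z ⟶ X⟦(1 : ℤ)⟧}
    (hT : Triangle.mk f g h ∈ distTriang C) :
    ∃ h', Triangle.mk (f⟦(1 : ℤ)⟧') (g⟦(1 : ℤ)⟧') h' ∈ distTriang C := by
  have h := rot_of_distTriang _ (rot_of_distTriang _ (rot_of_distTriang _ hT))
  exact ⟨_, mem_distTriang_of_neg h⟩

/-- A contravariant fully faithful triangulated functor whose square is objectwise isomorphic to
the identity. -/
structure IsDuality (F : Cᵒᵖ ⥤ C) : Prop where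
  additive : F.Additive
  full : F.Full
  faithful : F.Faithful
  bidual (X : C) : Nonempty (F.obj (.op (F.obj (.op X))) ≅ X)
  shift (X : C) (n : ℤ) : Nonempty (F.obj (.op (X⟦n⟧)) ≅ (F.obj (.op X))⟦-n⟧)
  triangle (T : Triangle C) : T ∈ distTriang C →
    ∃ h, Triangle.mk (F.map T.mor₂.op) (F.map T.mor₁.op) h ∈ distTriang C

/-! ### Transport of silting theory along a duality -/

namespace IsDuality

variable {F : Cᵒᵖ ⥤ C} (hF : IsDuality F)
include hF

/-- As `(F T)[i] ≅ F (T[-i])`, fullness makes `f` come from a map `T[-i] ⟶ U`, whose shift by `i` is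
a map `T ⟶ U[i]` up to isomorphism, hence zero. -/
lemma ge {T U : C} (h : GE T U) : GE (F.obj (.op U)) (F.obj (.op T)) := by
  have := hF.full
  have := hF.additive
  intro i hi f
  obtain ⟨a⟩ := hF.shift T (-i)
  let a' := a ≪≫ eqToIso (by rw [neg_neg])
  obtain ⟨g, hg⟩ := F.map_surjective (f ≫ a'.inv)
  have hg0 : g.unop = 0 := by
    apply (shiftFunctor C i).map_injective
    rw [Functor.map_zero]
    exact (cancel_epi (shiftNegShift T i).inv).1
      ((h i hi ((shiftNegShift T i).inv ≫ g.unop⟦i⟧')).trans comp_zero.symm)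
  rw [← cancel_mono a'.inv, ← hg, ← g.op_unop, hg0]
  simp

lemma isZero_iff (X : C) : IsZero (F.obj (.op X)) ↔ IsZero X := by
  have := hF.faithful
  have := hF.additive
  rw [IsZero.iff_id_eq_zero, IsZero.iff_id_eq_zero, ← F.map_id, F.map_eq_zero_iff]
  exact ⟨fun h => Quiver.Hom.op_inj h, fun h => congrArg Quiver.Hom.op h⟩

lemma indecomposable {X : C} (h : Indecomposable X) : Indecomposable (F.obj (.op X)) := by
  have := hF.additive
  refine ⟨fun h0 => h.1 ((hF.isZero_iff X).1 h0), fun Y Z e => ?_⟩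
  obtain ⟨a⟩ := hF.bidual X
  simpa only [hF.isZero_iff] using
    h.2 _ _ (a.symm ≪≫ F.mapIso e.symm.op ≪≫ mapOpBiprod F Y Z)

lemma isBasic {T : C} (h : IsBasic T) : IsBasic (F.obj (.op T)) := by
  have := hF.additive
  obtain ⟨n, X, h₁, h₂, ⟨e⟩⟩ := h
  refine ⟨n, fun i => F.obj (.op (X i)), fun i => hF.indecomposable (h₁ i),
    fun i j hij => ⟨fun a => ?_⟩, ⟨F.mapIso e.symm.op ≪≫ mapOpBiproduct F X⟩⟩
  obtain ⟨b⟩ := hF.bidual (X i)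
  obtain ⟨c⟩ := hF.bidual (X j)
  exact (h₂ i j hij).elim (b.symm ≪≫ F.mapIso a.symm.op ≪≫ c)

lemma add {M X : C} (h : add M X) : add (F.obj (.op M)) (F.obj (.op X)) := by
  have := hF.additive
  obtain ⟨n, Z, ⟨e⟩⟩ := h
  exact ⟨n, F.obj (.op Z),
    ⟨(mapOpBiproduct F _).symm ≪≫ F.mapIso e.symm.op ≪≫ mapOpBiprod F X Z⟩⟩

lemma add_iff {M X : C} : Silting.add (F.obj (.op M)) X ↔ Silting.add M (F.obj (.op X)) := by
  obtain ⟨a⟩ := hF.bidual M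
  obtain ⟨b⟩ := hF.bidual X
  exact ⟨fun h => add.of_iso a (Iso.refl _) (hF.add h),
    fun h => add.of_iso (Iso.refl _) b (hF.add h)⟩

lemma isBasicVersion {B L : C} (h : IsBasicVersion B L) :
    IsBasicVersion (F.obj (.op B)) (F.obj (.op L)) := by
  refine ⟨hF.isBasic h.1, ?_⟩
  ext X
  rw [hF.add_iff, hF.add_iff, h.2]

/-- A test object `N` is isomorphic to `F (F N)` with `F N` in `add M`, so fullness turns each test
map into the image of one that factors through `f`. -/
lemma isMinimalRightApprox {M X M' : C} {f : X ⟶ M'} (h : IsMinimalLeftApprox M f) :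
    IsMinimalRightApprox (F.obj (.op M)) (F.map f.op) where
  mem_add := hF.add h.mem_add
  factors N hN g := by
    have := hF.full
    obtain ⟨a⟩ := hF.bidual N
    obtain ⟨g', hg'⟩ := F.map_surjective (a.hom ≫ g)
    obtain ⟨k, hk⟩ := h.factors _ (hF.add_iff.1 hN) g'.unop
    refine ⟨a.inv ≫ F.map k.op, ?_⟩
    rw [Category.assoc, ← F.map_comp, ← op_comp, hk, Quiver.Hom.op_unop, hg', a.inv_hom_id_assoc]
  minimal k hk := by
    have := hF.full
    have := hF.faithful
    obtain ⟨k, rfl⟩ := F.map_surjective k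
    rw [← F.map_comp] at hk
    have := h.minimal k.unop (Quiver.Hom.op_inj (F.map_injective hk))
    have : IsIso k := (isIso_unop_iff k).1 this
    infer_instance

lemma isMinimalLeftApprox {M X M' : C} {f : M' ⟶ X} (h : IsMinimalRightApprox M f) :
    IsMinimalLeftApprox (F.obj (.op M)) (F.map f.op) where
  mem_add := hF.add h.mem_add
  factors N hN g := by
    have := hF.full
    obtain ⟨a⟩ := hF.bidual N
    obtain ⟨g', hg'⟩ := F.map_surjective (g ≫ a.inv)
    obtain ⟨k, hk⟩ := h.factors _ (hF.add_iff.1 hN) g'.unop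
    refine ⟨F.map k.op ≫ a.hom, ?_⟩
    rw [← Category.assoc, ← F.map_comp, ← op_comp, hk, Quiver.Hom.op_unop, hg', Category.assoc,
      a.inv_hom_id, Category.comp_id]
  minimal k hk := by
    have := hF.full
    have := hF.faithful
    obtain ⟨k, rfl⟩ := F.map_surjective k
    rw [← F.map_comp] at hk
    have := h.minimal k.unop (Quiver.Hom.op_inj (F.map_injective hk))
    have : IsIso k := (isIso_unop_iff k).1 this
    infer_instance

lemma isRightMutation {T X U : C} (h : IsLeftMutation T X U) :
    IsRightMutation (F.obj (.op T)) (F.obj (.op X)) (F.obj (.op U)) := by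
  have := hF.additive
  obtain ⟨M, M', Y, f, g, h, ⟨e⟩, hf, hT, ⟨e'⟩⟩ := h
  obtain ⟨k, hk⟩ := hF.triangle _ hT
  exact ⟨F.obj (.op M), _, _, F.map g.op, F.map f.op, k,
    ⟨F.mapIso e.symm.op ≪≫ mapOpBiprod F X M⟩, hF.isMinimalRightApprox hf, hk,
    ⟨F.mapIso e'.symm.op ≪≫ mapOpBiprod F Y M⟩⟩

lemma isLeftMutation {T X U : C} (h : IsRightMutation T X U) :
    IsLeftMutation (F.obj (.op T)) (F.obj (.op X)) (F.obj (.op U)) := by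
  have := hF.additive
  obtain ⟨M, M', Y, g, f, h, ⟨e⟩, hf, hT, ⟨e'⟩⟩ := h
  obtain ⟨k, hk⟩ := hF.triangle _ hT
  exact ⟨F.obj (.op M), _, _, F.map f.op, F.map g.op, k,
    ⟨F.mapIso e.symm.op ≪≫ mapOpBiprod F X M⟩, hF.isMinimalLeftApprox hf, hk,
    ⟨F.mapIso e'.symm.op ≪≫ mapOpBiprod F Y M⟩⟩

/-- Shifts change sign and the outer terms of a triangle trade places, but both closure conditions
are symmetric under this. -/
lemma isTriangulated_preimage (Q : ObjectProperty C) [Q.IsTriangulated]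
    [Q.IsClosedUnderIsomorphisms] :
    ObjectProperty.IsTriangulated (fun X : C => Q (F.obj (.op X))) where
  exists_zero := ⟨0, isZero_zero C, Q.prop_of_isZero ((hF.isZero_iff _).2 (isZero_zero C))⟩
  isStableUnderShiftBy n := ⟨fun X hX => by
    obtain ⟨a⟩ := hF.shift X n
    exact Q.prop_of_iso a.symm (Q.le_shift (-n) _ hX)⟩
  ext₂' T hT h₁ h₃ := by
    obtain ⟨k, hk⟩ := hF.triangle _ hT
    exact ObjectProperty.le_isoClosure _ _ (Q.ext_of_isTriangulatedClosed₂ _ hk h₃ h₁)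

/-- A thick `Q` containing `F T` pulls back to a thick subcategory containing `T`, hence containing
every `F X`; so `Q` contains `F (F X) ≅ X`. -/
lemma isSilting {T : C} (h : IsSilting T) : IsSilting (F.obj (.op T)) where
  hom_eq_zero := hF.ge h.hom_eq_zero
  thick_eq_top := by
    ext X
    simp only [Pi.top_apply, Prop.top_eq_true, iff_true]
    intro Q hQ hQ' hT
    obtain ⟨a⟩ := hF.bidual X
    refine Q.prop_of_iso a ((h.thick_eq_top.ge (F.obj (.op X)) trivial)
      (fun X : C => Q (F.obj (.op X))) (hF.isTriangulated_preimage Q) ⟨fun {X Y} r hY => ?_⟩ hT)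
    exact Q.prop_of_retract (⟨F.map r.r.op, F.map r.i.op, by
      rw [← F.map_comp, ← op_comp, r.retract, op_id, F.map_id]⟩ : Retract _ _) hY

/-- The contravariant self-map of the type of basic silting objects. -/
def basicSilting (T : BasicSilting C) : BasicSilting C :=
  ⟨F.obj (.op T.1), hF.isSilting T.2.1, hF.isBasic T.2.2⟩

/-- The order-reversing involution of `Silt C`. -/
def silt : Silt C → Silt C :=
  Quotient.map hF.basicSilting fun _ _ ⟨a⟩ => ⟨F.mapIso a.symm.op⟩

lemma silt_silt (t : Silt C) : hF.silt (hF.silt t) = t := by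
  induction t using Quotient.inductionOn with
  | h T => exact Quotient.sound (hF.bidual T.1)

lemma silt_le {t u : Silt C} (h : t ≤ u) : hF.silt u ≤ hF.silt t := by
  induction t using Quotient.inductionOn with
  | h T => induction u using Quotient.inductionOn with
    | h U => exact hF.ge h

lemma silt_mem_twoSilt {L : C} (a : F.obj (.op L) ≅ L⟦(1 : ℤ)⟧)
    (b : F.obj (.op (L⟦(1 : ℤ)⟧)) ≅ L) {t : Silt C} (h : t ∈ twoSilt L) :
    hF.silt t ∈ twoSilt L := by
  obtain ⟨T, rfl, h₁, h₂⟩ := h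
  exact ⟨hF.basicSilting T, rfl, GE.of_iso b (Iso.refl _) (hF.ge h₂),
    GE.of_iso (Iso.refl _) a (hF.ge h₁)⟩

lemma silt_mem_TPlus {L P : C} (a : F.obj (.op L) ≅ L⟦(1 : ℤ)⟧)
    (b : F.obj (.op (L⟦(1 : ℤ)⟧)) ≅ L) (c : F.obj (.op P) ≅ P⟦(1 : ℤ)⟧) {t : Silt C}
    (h : t ∈ TMinus L P) : hF.silt t ∈ TPlus L P := by
  obtain ⟨h, T, rfl, B, U, hB, hU, h₁, h₂⟩ := h
  exact ⟨hF.silt_mem_twoSilt a b h, hF.basicSilting T, rfl, F.obj (.op B), F.obj (.op U),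
    (hF.isBasicVersion hB).of_iso a, (hF.isRightMutation hU).of_iso c,
    GE.of_iso b (Iso.refl _) (hF.ge h₂), hF.ge h₁⟩

lemma silt_mem_TMinus {L P : C} (a : F.obj (.op L) ≅ L⟦(1 : ℤ)⟧)
    (b : F.obj (.op (L⟦(1 : ℤ)⟧)) ≅ L) (c : F.obj (.op (P⟦(1 : ℤ)⟧)) ≅ P) {t : Silt C}
    (h : t ∈ TPlus L P) : hF.silt t ∈ TMinus L P := by
  obtain ⟨h, T, rfl, B, U, hB, hU, h₁, h₂⟩ := h
  exact ⟨hF.silt_mem_twoSilt a b h, hF.basicSilting T, rfl, F.obj (.op B), F.obj (.op U),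
    (hF.isBasicVersion hB).of_iso b, (hF.isLeftMutation hU).of_iso c,
    hF.ge h₂, GE.of_iso (Iso.refl _) a (hF.ge h₁)⟩

/-- A duality exchanging `L` with `L⟦1⟧` and `P` with `P⟦1⟧` exchanges `TMinus L P` with
`TPlus L P`. -/
def tMinusOrderIso {L P : C} (a : F.obj (.op L) ≅ L⟦(1 : ℤ)⟧)
    (b : F.obj (.op (L⟦(1 : ℤ)⟧)) ≅ L) (c : F.obj (.op P) ≅ P⟦(1 : ℤ)⟧)
    (d : F.obj (.op (P⟦(1 : ℤ)⟧)) ≅ P) : TMinus L P ≃o (TPlus L P)ᵒᵈ where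
  toFun t := OrderDual.toDual ⟨hF.silt t.1, hF.silt_mem_TPlus a b c t.2⟩
  invFun t := ⟨hF.silt (OrderDual.ofDual t).1, hF.silt_mem_TMinus a b d (OrderDual.ofDual t).2⟩
  left_inv t := Subtype.ext (hF.silt_silt _)
  right_inv t := congrArg OrderDual.toDual (Subtype.ext (hF.silt_silt _))
  map_rel_iff' {t u} := by
    refine ⟨fun h => ?_, fun h => hF.silt_le h⟩
    have : hF.silt (hF.silt t.1) ≤ hF.silt (hF.silt u.1) := hF.silt_le h
    rwa [hF.silt_silt, hF.silt_silt] at this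

/-- The square is still the identity on objects because `F` turns `[1]` into `[-1]`, which cancels
the outer shift. -/
lemma comp_shift : IsDuality (F ⋙ shiftFunctor C (1 : ℤ)) where
  additive := by
    have := hF.additive
    infer_instance
  full := by
    have := hF.full
    infer_instance
  faithful := by
    have := hF.faithful
    infer_instance
  bidual X := by
    obtain ⟨a⟩ := hF.bidual X
    obtain ⟨b⟩ := hF.shift (F.obj (.op X)) 1
    exact ⟨(shiftFunctor C (1 : ℤ)).mapIso b ≪≫ shiftNegShift _ _ ≪≫ a⟩
  shift X n := by
    obtain ⟨a⟩ := hF.shift X n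
    exact ⟨(shiftFunctor C (1 : ℤ)).mapIso a ≪≫ shiftComm _ _ _⟩
  triangle T hT := by
    obtain ⟨h, hh⟩ := hF.triangle T hT
    exact exists_mem_distTriang_shift hh

end IsDuality

end Triangulated

/-! ### Transport and reflection of distinguished triangles -/

section

universe w' w

variable {C : Type w} [Category.{w'} C] [Preadditive C] [HasZeroObject C] [HasShift C ℤ]
  [∀ n : ℤ, (shiftFunctor C n).Additive] [Pretriangulated C]

lemma exists_mem_distTriang_of_iso {T : Triangle C} (hT : T ∈ distTriang C) {X Y Z : C}
    {f : X ⟶ Y} {g : Y ⟶ Z} (a : X ≅ T.obj₁) (b : Y ≅ T.obj₂) (c : Z ≅ T.obj₃)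
    (hf : f ≫ b.hom = a.hom ≫ T.mor₁) (hg : g ≫ c.hom = b.hom ≫ T.mor₂) :
    ∃ h, Triangle.mk f g h ∈ distTriang C := by
  refine ⟨c.hom ≫ T.mor₃ ≫ a.inv⟦1⟧', isomorphic_distinguished _ hT _
    (Triangle.isoMk _ _ a b c hf hg ?_)⟩
  change (c.hom ≫ T.mor₃ ≫ a.inv⟦1⟧') ≫ a.hom⟦1⟧' = c.hom ≫ T.mor₃
  rw [Category.assoc, Category.assoc, ← Functor.map_comp, a.inv_hom_id,
    CategoryTheory.Functor.map_id, Category.comp_id]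

/-- Fullness lifts the third map. This brings triangles from the unbounded homotopy category back to
the bounded one. -/
lemma exists_mem_distTriang_of_map {E : Type*} [Category* E] [Preadditive E] [HasZeroObject E]
    [HasShift E ℤ] [∀ n : ℤ, (shiftFunctor E n).Additive] [Pretriangulated E]
    (G : C ⥤ E) [G.CommShift ℤ] [G.IsTriangulated] [G.Full] [G.Faithful] {X Y Z : C}
    {f : X ⟶ Y} {g : Y ⟶ Z} {h : G.obj Z ⟶ (G.obj X)⟦(1 : ℤ)⟧}
    (hT : Triangle.mk (G.map f) (G.map g) h ∈ distTriang E) :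
    ∃ k, Triangle.mk f g k ∈ distTriang C := by
  obtain ⟨k, hk⟩ := G.map_surjective (h ≫ (G.commShiftIso (1 : ℤ)).inv.app X)
  refine ⟨k, (G.map_distinguished_iff _).1
    (isomorphic_distinguished _ hT _ (Triangle.isoMk _ _ (Iso.refl _) (Iso.refl _) (Iso.refl _)
      ((Category.comp_id _).trans (Category.id_comp _).symm)
      ((Category.comp_id _).trans (Category.id_comp _).symm) ?_))⟩
  have e : G.map k ≫ (G.commShiftIso (1 : ℤ)).hom.app X = h := by
    rw [hk, Category.assoc, Iso.inv_hom_id_app]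
    exact Category.comp_id h
  refine (congrArg₂ (· ≫ ·) e
    (CategoryTheory.Functor.map_id (shiftFunctor E (1 : ℤ)) (G.obj X))).trans ?_
  exact (Category.comp_id h).trans (Category.id_comp h).symm

end

/-! ### The duality induced on complexes and on the bounded homotopy category -/

section Complexes

universe w' w

variable {D : Type w} [Category.{w'} D]

lemma faithful_of_rightOp_comp_iso {F : Dᵒᵖ ⥤ D} (η : F.rightOp ⋙ F ≅ 𝟭 D) : F.Faithful := by
  have : F.rightOp.Faithful := Functor.Faithful.of_comp_iso η
  exact ⟨fun {X Y} f g h => Quiver.Hom.unop_inj (F.rightOp.map_injective (Quiver.Hom.unop_inj h))⟩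

lemma full_of_rightOp_comp_iso {F : Dᵒᵖ ⥤ D} (η : F.rightOp ⋙ F ≅ 𝟭 D) : F.Full := by
  have := faithful_of_rightOp_comp_iso η
  have : F.rightOp.Full := Functor.Full.of_comp_faithful_iso η
  refine ⟨fun {X Y} f => ?_⟩
  obtain ⟨g, hg⟩ := F.rightOp.map_surjective f.op
  exact ⟨g.op, Quiver.Hom.op_inj hg⟩

variable [Preadditive D] (δ : Dᵒᵖ ⥤ D) [δ.Additive]

/-- The contravariant functor on cochain complexes induced by a contravariant functor. -/
def dualComplex : (CochainComplex D ℤ)ᵒᵖ ⥤ CochainComplex D ℤ :=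
  (CochainComplex.opEquivalence D).functor ⋙ δ.mapHomologicalComplex (ComplexShape.up ℤ)

/-- Homotopies dualise, and a homotopy between dual maps lifts back because `δ` is fully faithful.
This gives faithfulness on the homotopy category. -/
lemma dualComplex_map_eq_iff [δ.Full] [δ.Faithful] {K L : CochainComplex D ℤ} (f g : K ⟶ L) :
    (HomotopyCategory.quotient D _).map ((dualComplex δ).map f.op) =
      (HomotopyCategory.quotient D _).map ((dualComplex δ).map g.op) ↔
    (HomotopyCategory.quotient D _).map f = (HomotopyCategory.quotient D _).map g := by
  refine ⟨fun h => HomotopyCategory.eq_of_homotopy _ _ (CochainComplex.homotopyUnop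
    (δ.preimageHomotopy (HomotopyCategory.homotopyOfEq _ _ h))), fun h =>
    HomotopyCategory.eq_of_homotopy _ _ (δ.mapHomotopy
      (CochainComplex.homotopyOp (HomotopyCategory.homotopyOfEq _ _ h)))⟩

instance [δ.Full] [δ.Faithful] : (dualComplex δ).Full :=
  inferInstanceAs (((CochainComplex.opEquivalence D).functor ⋙
    δ.mapHomologicalComplex (ComplexShape.up ℤ)).Full)

/-- The contravariant functor on the homotopy category induced by a contravariant functor. -/
def dualHomotopy : (HomotopyCategory D (ComplexShape.up ℤ))ᵒᵖ ⥤
    HomotopyCategory D (ComplexShape.up ℤ) :=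
  Functor.leftOp (CategoryTheory.Quotient.lift _
    (dualComplex δ ⋙ HomotopyCategory.quotient D (ComplexShape.up ℤ)).rightOp
    (fun _ _ _ _ ⟨h⟩ => congrArg Quiver.Hom.op (HomotopyCategory.eq_of_homotopy _ _
      (δ.mapHomotopy (CochainComplex.homotopyOp h)))))

instance : (dualComplex δ).Additive where
  map_add {X Y f g} := by
    ext n
    exact δ.map_add

instance : (dualHomotopy δ).Additive where
  map_add := by
    rintro ⟨⟨K⟩⟩ ⟨⟨L⟩⟩ ⟨⟨f⟩⟩ ⟨⟨g⟩⟩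
    exact congrArg (HomotopyCategory.quotient D (ComplexShape.up ℤ)).map
      ((dualComplex δ).map_add (f := Quiver.Hom.op f) (g := Quiver.Hom.op g))

instance [δ.Full] [δ.Faithful] : (dualHomotopy δ).Full where
  map_surjective {X Y} f := by
    obtain ⟨f, rfl⟩ := (HomotopyCategory.quotient D (ComplexShape.up ℤ)).map_surjective f
    obtain ⟨g, rfl⟩ := (dualComplex δ).map_surjective f
    exact ⟨((HomotopyCategory.quotient D (ComplexShape.up ℤ)).map g.unop).op, rfl⟩

instance [δ.Full] [δ.Faithful] : (dualHomotopy δ).Faithful where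
  map_injective := by
    rintro ⟨⟨K⟩⟩ ⟨⟨L⟩⟩ ⟨⟨f⟩⟩ ⟨⟨g⟩⟩ h
    exact congrArg Quiver.Hom.op ((dualComplex_map_eq_iff δ f g).1 h)

/-- The double dual of a complex. -/
def dualComplexBidual (η : δ.rightOp ⋙ δ ≅ 𝟭 D) (K : CochainComplex D ℤ) :
    (dualComplex δ).obj (.op ((dualComplex δ).obj (.op K))) ≅ K :=
  HomologicalComplex.Hom.isoOfComponents
    (fun n => η.app (K.X (- -n)) ≪≫ K.XIsoOfEq (neg_neg n)) (fun i j _ => by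
      have h := η.hom.naturality (K.d (- -i) (- -j))
      change (η.hom.app (K.X (- -i)) ≫ (K.XIsoOfEq (neg_neg i)).hom) ≫ K.d i j =
        δ.map (δ.map (K.d (- -i) (- -j)).op).op ≫
          (η.hom.app (K.X (- -j)) ≫ (K.XIsoOfEq (neg_neg j)).hom)
      rw [← Category.assoc (δ.map _), Category.assoc, HomologicalComplex.XIsoOfEq_hom_comp_d,
        show δ.map (δ.map (K.d (- -i) (- -j)).op).op ≫ η.hom.app (K.X (- -j)) =
          η.hom.app (K.X (- -i)) ≫ K.d (- -i) (- -j) from h, Category.assoc,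
        HomologicalComplex.d_comp_XIsoOfEq_hom])

/-- Duality and shift. -/
def dualComplexShift (K : CochainComplex D ℤ) (n : ℤ) :
    (dualComplex δ).obj (.op (K⟦n⟧)) ≅ ((dualComplex δ).obj (.op K))⟦-n⟧ :=
  HomologicalComplex.Hom.isoOfComponents
    -- No sign is needed in the components: the shifts by `n` and by `-n` scale differentials by the
    -- same sign.
    (fun m => δ.mapIso (K.XIsoOfEq (show -(m + -n) = -m + n by lia)).op) (fun i j _ => by
      change δ.map (K.XIsoOfEq (show -(i + -n) = -i + n by lia)).hom.op ≫
          ((-n).negOnePow • δ.map (K.d (-(j + -n)) (-(i + -n))).op) =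
        δ.map (n.negOnePow • K.d (-j + n) (-i + n)).op ≫
          δ.map (K.XIsoOfEq (show -(j + -n) = -j + n by lia)).hom.op
      have : (n.negOnePow • K.d (-j + n) (-i + n)).op =
          n.negOnePow • (K.d (-j + n) (-i + n)).op := rfl
      rw [Int.negOnePow_neg, this, Functor.map_units_smul, Linear.comp_units_smul,
        Linear.units_smul_comp, ← δ.map_comp, ← δ.map_comp, ← op_comp, ← op_comp,
        HomologicalComplex.XIsoOfEq_hom_comp_d, HomologicalComplex.d_comp_XIsoOfEq_hom])

lemma dualComplex_isStrictlyLE (K : CochainComplex D ℤ) (a b : ℤ) (h : b = -a)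
    [K.IsStrictlyGE a] :
    ((dualComplex δ).obj (.op K)).IsStrictlyLE b := by
  rw [CochainComplex.isStrictlyLE_iff]
  intro i hi
  exact δ.map_isZero (K.isZero_of_isStrictlyGE a (-i) (by lia)).op

lemma dualComplex_isStrictlyGE (K : CochainComplex D ℤ) (a b : ℤ) (h : b = -a)
    [K.IsStrictlyLE a] :
    ((dualComplex δ).obj (.op K)).IsStrictlyGE b := by
  rw [CochainComplex.isStrictlyGE_iff]
  intro i hi
  exact δ.map_isZero (K.isZero_of_isStrictlyLE a (-i) (by lia)).op

variable [HasZeroObject D]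

/-- The dual is concentrated in degree `0`, hence is a stalk complex; evaluation in degree `0`
identifies its object. -/
lemma nonempty_dualComplex_single_iso (X : D) :
    Nonempty ((dualComplex δ).obj (.op ((CochainComplex.singleFunctor D 0).obj X)) ≅
      (CochainComplex.singleFunctor D 0).obj (δ.obj (.op X))) := by
  let K := (CochainComplex.singleFunctor D 0).obj X
  have : ((dualComplex δ).obj (.op K)).IsStrictlyGE 0 :=
    dualComplex_isStrictlyGE δ K 0 0 neg_zero.symm
  have : ((dualComplex δ).obj (.op K)).IsStrictlyLE 0 :=
    dualComplex_isStrictlyLE δ K 0 0 neg_zero.symm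
  obtain ⟨M, ⟨a⟩⟩ := CochainComplex.exists_iso_single ((dualComplex δ).obj (.op K)) 0
  let b : M ≅ δ.obj (.op X) :=
    (HomologicalComplex.singleObjXSelf (ComplexShape.up ℤ) 0 M).symm ≪≫
      (HomologicalComplex.eval D (ComplexShape.up ℤ) 0).mapIso a.symm ≪≫
      δ.mapIso (HomologicalComplex.singleObjXIsoOfEq (ComplexShape.up ℤ) 0 X (-0)
        (by simp)).symm.op
  exact ⟨a ≪≫ (HomologicalComplex.single D (ComplexShape.up ℤ) 0).mapIso b⟩

/-- The contravariant functor on the bounded homotopy category induced by a contravariant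
functor. -/
def dualKb : (Kb D)ᵒᵖ ⥤ Kb D :=
  (bounded D).lift ((bounded D).ι.op ⋙ dualHomotopy δ) (by
    rintro ⟨⟨K⟩, a, b, ha, hb⟩
    have := hb
    have := ha
    exact bounded_quotient_obj _ (-b) (-a) (dualComplex_isStrictlyGE δ K b _ rfl)
      (dualComplex_isStrictlyLE δ K a _ rfl))

/-- The dual of a stalk complex is the stalk complex of the dual. -/
lemma nonempty_dualKb_stalk_iso (X : D) :
    Nonempty ((dualKb δ).obj (.op (stalk X)) ≅ stalk (δ.obj (.op X))) := by
  obtain ⟨a⟩ := nonempty_dualComplex_single_iso δ X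
  exact ⟨(bounded D).fullyFaithfulι.preimageIso
    ((HomotopyCategory.quotient D (ComplexShape.up ℤ)).mapIso a)⟩

lemma nonempty_stalk_iso {X Y : D} (a : X ≅ Y) : Nonempty (stalk X ≅ stalk Y) :=
  ⟨(bounded D).fullyFaithfulι.preimageIso
    ((HomotopyCategory.quotient D (ComplexShape.up ℤ)).mapIso
      ((CochainComplex.singleFunctor D 0).mapIso a))⟩

variable [HasBinaryBiproducts D]

/-- Distinguished triangles are, up to isomorphism, those of degreewise split short exact sequences.
This class is visibly stable under duality, so no comparison of mapping cones is needed. -/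
lemma dualHomotopy_triangle (T : Triangle (HomotopyCategory D (ComplexShape.up ℤ)))
    (hT : T ∈ distTriang _) :
    ∃ h, Triangle.mk ((dualHomotopy δ).map T.mor₂.op) ((dualHomotopy δ).map T.mor₁.op) h ∈
      distTriang _ := by
  obtain ⟨S, σ, ⟨e⟩⟩ := (HomotopyCategory.distinguished_iff_iso_trianglehOfDegreewiseSplit T).1 hT
  let S' : ShortComplex (CochainComplex D ℤ) :=
    ShortComplex.mk ((dualComplex δ).map S.g.op) ((dualComplex δ).map S.f.op) (by
      rw [← Functor.map_comp, ← op_comp, S.zero, op_zero, Functor.map_zero])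
  let σ' : ∀ n, (S'.map (HomologicalComplex.eval D _ n)).Splitting := fun n =>
    (σ (-n)).op.map δ
  have hS' := (HomotopyCategory.distinguished_iff_iso_trianglehOfDegreewiseSplit
    (CochainComplex.trianglehOfDegreewiseSplit S' σ')).2 ⟨S', σ', ⟨Iso.refl _⟩⟩
  refine exists_mem_distTriang_of_iso hS' ((dualHomotopy δ).mapIso (Triangle.π₃.mapIso e).symm.op)
    ((dualHomotopy δ).mapIso (Triangle.π₂.mapIso e).symm.op)
    ((dualHomotopy δ).mapIso (Triangle.π₁.mapIso e).symm.op) ?_ ?_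
  · have := congrArg (fun f => (dualHomotopy δ).map f.op) e.inv.comm₂
    simp only [op_comp, Functor.map_comp] at this
    exact this.symm
  · have := congrArg (fun f => (dualHomotopy δ).map f.op) e.inv.comm₁
    simp only [op_comp, Functor.map_comp] at this
    exact this.symm

lemma isDuality_dualKb (η : δ.rightOp ⋙ δ ≅ 𝟭 D) : IsDuality (dualKb δ) where
  additive := ⟨fun {X Y f g} => (bounded D).ι.map_injective
    ((dualHomotopy δ).map_add (f := f.unop.hom.op) (g := g.unop.hom.op))⟩
  full := by
    have := full_of_rightOp_comp_iso η
    have := faithful_of_rightOp_comp_iso η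
    exact inferInstanceAs ((bounded D).lift ((bounded D).ι.op ⋙ dualHomotopy δ) _).Full
  faithful := by
    have := full_of_rightOp_comp_iso η
    have := faithful_of_rightOp_comp_iso η
    exact inferInstanceAs ((bounded D).lift ((bounded D).ι.op ⋙ dualHomotopy δ) _).Faithful
  bidual := by
    rintro ⟨⟨K⟩, h⟩
    exact ⟨(bounded D).fullyFaithfulι.preimageIso
      ((HomotopyCategory.quotient D (ComplexShape.up ℤ)).mapIso (dualComplexBidual δ η K))⟩
  shift := by
    rintro ⟨⟨K⟩, h⟩ n
    refine ⟨(bounded D).fullyFaithfulι.preimageIso ?_⟩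
    let q := HomotopyCategory.quotient D (ComplexShape.up ℤ)
    refine ((dualHomotopy δ).mapIso (((bounded D).ι.commShiftIso n).app _).symm.op) ≪≫
      (dualHomotopy δ).mapIso ((q.commShiftIso n).app K).op ≪≫
      q.mapIso (dualComplexShift δ K n) ≪≫ (q.commShiftIso (-n)).app _ ≪≫
      (((bounded D).ι.commShiftIso (-n)).app ((dualKb δ).obj (.op ⟨⟨K⟩, h⟩))).symm
  triangle T hT := by
    obtain ⟨h, hh⟩ := dualHomotopy_triangle δ _ ((bounded D).ι.map_distinguished T hT)
    exact exists_mem_distTriang_of_map (bounded D).ι (X := (dualKb δ).obj (.op T.obj₃))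
      (Y := (dualKb δ).obj (.op T.obj₂)) (Z := (dualKb δ).obj (.op T.obj₁))
      (f := (dualKb δ).map T.mor₂.op) (g := (dualKb δ).map T.mor₁.op) (h := h) hh

end Complexes

/-! ### The duality `Hom_A(-, A)` twisted by an anti-involution -/

section TwistedDual

universe v

variable {A : Type v} [Ring A] (τ : Aᵐᵒᵖ →+* A)

/-- The dual `Hom_A(M, A)` of a right module `M`, a left module turned into a right module by the
anti-endomorphism `τ` of `A`. -/
def TwistedDual (_ : Aᵐᵒᵖ →+* A) (M : Type v) [AddCommGroup M] [Module Aᵐᵒᵖ M] : Type v :=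
  M →ₗ[Aᵐᵒᵖ] A

namespace TwistedDual

variable {M N : Type v} [AddCommGroup M] [Module Aᵐᵒᵖ M] [AddCommGroup N] [Module Aᵐᵒᵖ N]

instance : AddCommGroup (TwistedDual τ M) := inferInstanceAs (AddCommGroup (M →ₗ[Aᵐᵒᵖ] A))

instance : Module Aᵐᵒᵖ (TwistedDual τ M) := Module.compHom (M →ₗ[Aᵐᵒᵖ] A) τ

instance : FunLike (TwistedDual τ M) M A := inferInstanceAs (FunLike (M →ₗ[Aᵐᵒᵖ] A) M A)

instance : LinearMapClass (TwistedDual τ M) Aᵐᵒᵖ M A :=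
  inferInstanceAs (LinearMapClass (M →ₗ[Aᵐᵒᵖ] A) Aᵐᵒᵖ M A)

variable {τ}

@[ext]
lemma ext {φ ψ : TwistedDual τ M} (h : ∀ m, φ m = ψ m) : φ = ψ := DFunLike.ext _ _ h

@[simp]
lemma add_apply (φ ψ : TwistedDual τ M) (m : M) : (φ + ψ) m = φ m + ψ m := rfl

@[simp]
lemma smul_apply (r : Aᵐᵒᵖ) (φ : TwistedDual τ M) (m : M) : (r • φ) m = τ r * φ m := rfl

@[simp]
lemma sum_apply {ι : Type*} (s : Finset ι) (φ : ι → TwistedDual τ M) (m : M) :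
    (∑ i ∈ s, φ i) m = ∑ i ∈ s, φ i m :=
  LinearMap.sum_apply s φ m

lemma map_op_smul (φ : TwistedDual τ M) (a : A) (m : M) :
    φ (MulOpposite.op a • m) = φ m * a :=
  map_smul φ (MulOpposite.op a) m

variable (τ) in
/-- Precomposition with a linear map. -/
def map (f : M →ₗ[Aᵐᵒᵖ] N) : TwistedDual τ N →ₗ[Aᵐᵒᵖ] TwistedDual τ M where
  toFun φ := LinearMap.comp (show N →ₗ[Aᵐᵒᵖ] A from φ) f
  map_add' _ _ := rfl
  map_smul' _ _ := rfl

variable (τ M) in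
/-- Finitely generated projective modules have dual bases. -/
lemma exists_dualBasis [Module.Finite Aᵐᵒᵖ M] [Module.Projective Aᵐᵒᵖ M] :
    ∃ (n : ℕ) (b : Fin n → M) (φ : Fin n → TwistedDual τ M),
      ∀ m, ∑ i, MulOpposite.op (φ i m) • b i = m := by
  obtain ⟨n, f, g, -, -, h⟩ := Module.Finite.exists_comp_eq_id_of_projective Aᵐᵒᵖ M
  refine ⟨n, fun i => f (Pi.single i 1),
    fun i => (regularEquiv A).toLinearMap.comp ((LinearMap.proj i).comp g), fun m => ?_⟩
  change ∑ i, g m i • f (Pi.single i 1) = m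
  conv_rhs => rw [← LinearMap.id_apply (R := Aᵐᵒᵖ) m, ← h, LinearMap.comp_apply,
    pi_eq_sum_univ (g m)]
  rw [map_sum]
  refine Finset.sum_congr rfl fun i _ => ?_
  rw [map_smul]
  congr 2
  ext j
  simp [Pi.single_apply, eq_comm]

variable (hτ : ∀ a, τ (.op (τ (.op a))) = a)

section

include hτ

/-- The dual basis of a twisted dual. -/
lemma sum_smul_dualBasis {n : ℕ} {b : Fin n → M} {φ : Fin n → TwistedDual τ M}
    (h : ∀ m, ∑ i, MulOpposite.op (φ i m) • b i = m) (ψ : TwistedDual τ M) :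
    ∑ i, MulOpposite.op (τ (.op (ψ (b i)))) • φ i = ψ := by
  ext m
  conv_rhs => rw [← h m]
  simp only [sum_apply, smul_apply, hτ, map_sum, map_op_smul]

/-- A dual basis `b`, `φ` of `M` makes the dual a retract of a free module: `φ` generates it, with
coordinates `τ (ψ (b i))`. -/
lemma finite_and_projective [Module.Finite Aᵐᵒᵖ M] [Module.Projective Aᵐᵒᵖ M] :
    Module.Finite Aᵐᵒᵖ (TwistedDual τ M) ∧ Module.Projective Aᵐᵒᵖ (TwistedDual τ M) := by
  obtain ⟨n, b, φ, h⟩ := exists_dualBasis τ M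
  let p : (Fin n → Aᵐᵒᵖ) →ₗ[Aᵐᵒᵖ] TwistedDual τ M := Fintype.linearCombination Aᵐᵒᵖ φ
  let j : TwistedDual τ M →ₗ[Aᵐᵒᵖ] (Fin n → Aᵐᵒᵖ) :=
    { toFun ψ i := .op (τ (.op (ψ (b i))))
      map_add' _ _ := by ext i; simp
      map_smul' r ψ := by
        ext i
        have : r = .op (τ (.op (τ r))) := by
          conv_lhs => rw [← MulOpposite.op_unop r, ← hτ r.unop, MulOpposite.op_unop]
        conv_rhs => rw [this]
        simp }
  have hpj : p.comp j = LinearMap.id := by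
    ext1 ψ
    exact sum_smul_dualBasis hτ h ψ
  exact ⟨Module.Finite.of_surjective p fun ψ => ⟨j ψ, LinearMap.congr_fun hpj ψ⟩,
    Module.Projective.of_split j p hpj⟩

end

include hτ in
lemma apply_op_apply (r : Aᵐᵒᵖ) : τ (.op (τ r)) = r.unop := hτ r.unop

/-- Evaluation, from a module to its double twisted dual. -/
def eval : M →ₗ[Aᵐᵒᵖ] TwistedDual τ (TwistedDual τ M) where
  toFun m :=
    -- Scalars act on `φ` by left multiplication by `τ r`; applying `τ` to the value turns this into
    -- right multiplication by `r`.
    { toFun := fun φ => τ (.op (φ m))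
      map_add' := by simp
      map_smul' := fun r φ => by
        rw [smul_apply, MulOpposite.op_mul, map_mul, apply_op_apply hτ]
        rfl }
  map_add' m m' := ext fun φ => by
    change τ (.op (φ (m + m'))) = τ (.op (φ m)) + τ (.op (φ m'))
    rw [map_add, MulOpposite.op_add, map_add]
  map_smul' r m := ext fun φ => by
    change τ (.op (φ (MulOpposite.op r.unop • m))) = τ r * τ (.op (φ m))
    rw [map_op_smul, MulOpposite.op_mul, map_mul, MulOpposite.op_unop]

lemma eval_apply (m : M) (φ : TwistedDual τ M) : eval hτ m φ = τ (.op (φ m)) := rfl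

/-- If every functional kills `m`, its dual basis expansion is zero. Surjectivity follows by
expanding functionals in the basis `φ`. -/
lemma bijective_eval [Module.Finite Aᵐᵒᵖ M] [Module.Projective Aᵐᵒᵖ M] :
    Function.Bijective (eval hτ (M := M)) := by
  obtain ⟨n, b, φ, h⟩ := exists_dualBasis τ M
  have hτ' : Function.Injective fun a => τ (.op a) := fun a a' h => by
    rw [← hτ a, ← hτ a']
    exact congrArg (fun a => τ (.op a)) h
  refine ⟨(injective_iff_map_eq_zero _).2 fun m hm => ?_, fun ψ =>
    ⟨∑ i, MulOpposite.op (τ (.op (ψ (φ i)))) • b i, ?_⟩⟩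
  · rw [← h m]
    refine Finset.sum_eq_zero fun i _ => ?_
    have : τ (.op (φ i m)) = τ (.op 0) := by
      rw [← eval_apply hτ, hm, MulOpposite.op_zero, map_zero]
      rfl
    rw [hτ' this, MulOpposite.op_zero, zero_smul]
  · ext χ
    rw [eval_apply]
    conv_rhs => rw [← sum_smul_dualBasis hτ h χ]
    simp [map_sum, hτ]

/-- The twisted dual of `eA` is `eA` when `τ` fixes the idempotent `e`. -/
def rightIdealEquiv {e : A} (he : IsIdempotentElem e) (hτe : τ (.op e) = e) :
    TwistedDual τ (rightIdeal e) ≃ₗ[Aᵐᵒᵖ] rightIdeal e :=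
  have mul_coe (x : rightIdeal e) : e * x.1 = x := by
    obtain ⟨x, hx⟩ := x
    obtain ⟨r, rfl⟩ := Submodule.mem_span_singleton.1 hx
    change e * (e * r.unop) = e * r.unop
    rw [← mul_assoc, he.eq]
  { toFun := fun φ => ⟨τ (.op (φ ⟨e, Submodule.mem_span_singleton_self e⟩)), by
      -- From `e = e * e`, the value at `e` is fixed by right multiplication by `e`, so `τ` sends it
      -- into `eA`.
      have : φ ⟨e, Submodule.mem_span_singleton_self e⟩ =
          φ ⟨e, Submodule.mem_span_singleton_self e⟩ * e := by
        rw [← map_op_smul]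
        exact congrArg φ (Subtype.ext he.eq.symm)
      rw [this, MulOpposite.op_mul, map_mul, hτe]
      exact Submodule.mem_span_singleton.2 ⟨.op _, rfl⟩⟩
    invFun := fun a =>
      { toFun := fun x => τ (.op a) * x
        map_add' := fun x y => mul_add _ x.1 y.1
        map_smul' := fun r x => (mul_assoc (τ (.op a)) x r.unop).symm }
    map_add' := fun φ ψ => Subtype.ext (by simp)
    map_smul' := fun r φ => Subtype.ext (by
      change τ (.op (τ r * φ _)) = τ (.op (φ _)) * r.unop
      rw [MulOpposite.op_mul, map_mul, apply_op_apply hτ])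
    left_inv := fun φ => by
      ext x
      change τ (.op (τ (.op (φ _)))) * x.1 = φ x
      rw [hτ, ← map_op_smul]
      exact congrArg φ (Subtype.ext (mul_coe x))
    right_inv := fun a => Subtype.ext (by
      change τ (.op (τ (.op a) * e)) = a
      rw [MulOpposite.op_mul, map_mul, hτ, hτe, mul_coe]) }

/-- The twisted dual of `A` is `A`. -/
def regularDualEquiv : TwistedDual τ A ≃ₗ[Aᵐᵒᵖ] A where
  toFun φ := τ (.op (φ 1))
  invFun a :=
    { toFun := fun x => τ (.op a) * x
      map_add' := mul_add _
      map_smul' := fun r x => (mul_assoc (τ (.op a)) x r.unop).symm }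
  map_add' φ ψ := by simp
  map_smul' r φ := by
    rw [smul_apply, MulOpposite.op_mul, map_mul, apply_op_apply hτ]
    rfl
  left_inv φ := by
    ext x
    change τ (.op (τ (.op (φ 1)))) * x = φ x
    rw [hτ, ← map_op_smul]
    exact congrArg φ (one_mul x)
  right_inv a := by
    change τ (.op (τ (.op a) * 1)) = a
    rw [mul_one, hτ]

end TwistedDual

/-- The twisted duality on finitely generated projective right modules. -/
def projDual (hτ : ∀ a, τ (.op (τ (.op a))) = a) : (Proj A)ᵒᵖ ⥤ Proj A where
  obj M := ⟨ModuleCat.of Aᵐᵒᵖ (TwistedDual τ M.unop.obj), by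
    have := M.unop.property.1
    have := M.unop.property.2
    exact TwistedDual.finite_and_projective hτ⟩
  map f := ObjectProperty.homMk (ModuleCat.ofHom (TwistedDual.map τ f.unop.hom.hom))

instance (hτ : ∀ a, τ (.op (τ (.op a))) = a) : (projDual τ hτ).Additive where
  map_add {X Y f g} := by
    ext φ
    exact TwistedDual.ext (τ := τ) fun m => map_add (show TwistedDual τ X.unop.obj from φ) _ _

/-- The twisted duality is involutive. -/
def projDualBidual (hτ : ∀ a, τ (.op (τ (.op a))) = a) :
    (projDual τ hτ).rightOp ⋙ projDual τ hτ ≅ 𝟭 (Proj A) :=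
  (NatIso.ofComponents (fun M => ObjectProperty.isoMk _ (LinearEquiv.toModuleIso (by
      have := M.property.1
      have := M.property.2
      exact LinearEquiv.ofBijective _ (TwistedDual.bijective_eval hτ (M := M.obj)))))
    (fun {M N} f => by
      ext m
      rfl)).symm

lemma nonempty_stalk_dual_iso (hτ : ∀ a, τ (.op (τ (.op a))) = a) {M : ModuleCat.{v} Aᵐᵒᵖ}
    (hM : isProj A M) (a : TwistedDual τ M ≃ₗ[Aᵐᵒᵖ] M) :
    Nonempty ((dualKb (projDual τ hτ)).obj (.op (stalk ⟨M, hM⟩)) ≅ stalk ⟨M, hM⟩) := by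
  obtain ⟨b⟩ := nonempty_dualKb_stalk_iso (projDual τ hτ) ⟨M, hM⟩
  obtain ⟨c⟩ := nonempty_stalk_iso (X := (projDual τ hτ).obj (.op ⟨M, hM⟩)) (Y := ⟨M, hM⟩)
    (ObjectProperty.isoMk _ a.toModuleIso)
  exact ⟨b ≪≫ c⟩

/-- An involutive anti-automorphism of `A` fixing the idempotent `e` gives an anti-isomorphism
between `TMinus` and `TPlus` for the module `eA`. -/
theorem nonempty_tMinus_orderIso (hτ : ∀ a, τ (.op (τ (.op a))) = a) {e : A}
    (he : IsIdempotentElem e) (hτe : τ (.op e) = e) :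
    Nonempty (TMinus (regular A) (idempotentProj he) ≃o
      (TPlus (regular A) (idempotentProj he))ᵒᵈ) := by
  have hF := isDuality_dualKb _ (projDualBidual τ hτ)
  obtain ⟨a⟩ := nonempty_stalk_dual_iso τ hτ isProj_regular (TwistedDual.regularDualEquiv hτ)
  obtain ⟨b⟩ := nonempty_stalk_dual_iso τ hτ (isProj_rightIdeal he)
    (TwistedDual.rightIdealEquiv hτ he hτe)
  obtain ⟨a'⟩ := hF.shift (regular A) 1
  obtain ⟨b'⟩ := hF.shift (idempotentProj he) 1
  -- The unshifted duality `D` fixes both stalk complexes; the objects shifted by `1` return to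
  -- degree `0` because `D (X[1])[1] ≅ (D X)[-1][1]`.
  exact ⟨hF.comp_shift.tMinusOrderIso ((shiftFunctor _ (1 : ℤ)).mapIso a)
    ((shiftFunctor _ (1 : ℤ)).mapIso a' ≪≫ shiftNegShift _ _ ≪≫ a)
    ((shiftFunctor _ (1 : ℤ)).mapIso b)
    ((shiftFunctor _ (1 : ℤ)).mapIso b' ≪≫ shiftNegShift _ _ ≪≫ b)⟩

end TwistedDual

end Silting

/-! ### Finite dimensional algebras with only trivial idempotents -/

section LocalAlgebra

variable {K R : Type*} [Field K] [Ring R] [Algebra K R]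

open Polynomial in
-- Fitting's argument: write the minimal polynomial as `X ^ k * q` with `X ∤ q` and `u * X ^ k + v *
-- q = 1`. Then `u(x) * x ^ k` is idempotent; it is `0` when `x ^ k = 0`, and otherwise `1`, which
-- makes `x` a unit.
lemma isUnit_or_isNilpotent_of_forall_isIdempotentElem [FiniteDimensional K R]
    (hR : ∀ f : R, IsIdempotentElem f → f = 0 ∨ f = 1) (x : R) : IsUnit x ∨ IsNilpotent x := by
  have hx : IsIntegral K x := Algebra.IsIntegral.isIntegral x
  obtain ⟨q, hq, hdvd⟩ := exists_eq_pow_rootMultiplicity_mul_and_not_dvd (minpoly K x)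
    (minpoly.ne_zero hx) 0
  generalize (minpoly K x).rootMultiplicity 0 = k at hq
  obtain ⟨u, v, huv⟩ : IsCoprime ((X - C 0) ^ k) q :=
    ((irreducible_X_sub_C (0 : K)).coprime_iff_not_dvd.2 hdvd).pow_left
  have h0 : x ^ k * aeval x q = 0 := by
    simpa [hq] using minpoly.aeval K x
  have h1 : aeval x u * x ^ k + aeval x v * aeval x q = 1 := by
    simpa using congrArg (aeval x) huv
  have hc (p r : K[X]) : Commute (aeval x p) (aeval x r) := by
    rw [commute_iff_eq, ← map_mul, ← map_mul, mul_comm]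
  have hcx (p : K[X]) : Commute (aeval x p) (x ^ k) := by
    simpa using hc p (X ^ k)
  have hxq : aeval x q * x ^ k = 0 := by rw [(hcx q).eq, h0]
  obtain h | h := hR (aeval x u * x ^ k) (by
    have h2 := congrArg (aeval x u * x ^ k * ·) h1
    simp only [mul_add, mul_one] at h2
    rw [show aeval x u * x ^ k * (aeval x v * aeval x q) = 0 by
      rw [(hc v q).eq, ← mul_assoc, mul_assoc (aeval x u), h0, mul_zero, zero_mul], add_zero] at h2
    exact h2)
  · right
    rw [h, zero_add] at h1
    refine ⟨k, ?_⟩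
    rw [← one_mul (x ^ k), ← h1, mul_assoc, hxq, mul_zero]
  -- For `k = 0` the equation `h` does not involve `x`; instead `X` is coprime to the minimal
  -- polynomial, which yields an inverse.
  · obtain _ | k := k
    · left
      have hnd : IsCoprime (X : K[X]) (minpoly K x) := by
        rw [hq, pow_zero, one_mul]
        simpa using (irreducible_X_sub_C (0 : K)).coprime_iff_not_dvd.2 hdvd
      obtain ⟨a, b, hab⟩ := hnd
      have h2 : aeval x a * x = 1 := by simpa using congrArg (aeval x) hab
      have h3 : Commute (aeval x a) x := by simpa using hc a X
      exact ⟨⟨x, aeval x a, by rw [← h3.eq, h2], h2⟩, rfl⟩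
    · left
      refine ⟨⟨x, aeval x u * x ^ k, ?_, by rw [mul_assoc, ← pow_succ, h]⟩, rfl⟩
      have h3 : Commute (aeval x u) x := by simpa using hc u X
      rw [← mul_assoc, ← h3.eq, mul_assoc, ← pow_succ', h]

/-- A finite dimensional algebra over an algebraically closed field whose only idempotents are `0`
and `1` is local, with nilpotent radical and residue field `K`. -/
lemma exists_algHom_isNilpotent_ker [FiniteDimensional K R] [IsAlgClosed K] [Nontrivial R]
    (hR : ∀ f : R, IsIdempotentElem f → f = 0 ∨ f = 1) :
    ∃ π : R →ₐ[K] K, IsNilpotent (RingHom.ker π) := by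
  -- A nonunit `x` is nilpotent, so `y * x` is never a unit: a left inverse of `x` would force `1 =
  -- 0`. Hence `y * x` is nilpotent and `1 + y * x` is a unit.
  have hx (x : R) : IsUnit x ∨ x ∈ Ring.jacobson R := by
    refine (em (IsUnit x)).imp_right fun hx => ?_
    rw [← Ideal.jacobson_bot, Ideal.mem_jacobson_iff]
    intro y
    have hn := (isUnit_or_isNilpotent_of_forall_isIdempotentElem (K := K) hR x).resolve_left hx
    have hyx : ¬ IsUnit (y * x) := fun ⟨u, hu⟩ => by
      obtain ⟨n, hn⟩ := hn
      have h1 : (↑u⁻¹ * y) * x = 1 := by rw [mul_assoc, ← hu, Units.inv_mul]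
      have := pow_mul_pow_eq_one n h1
      rw [hn, mul_zero] at this
      exact zero_ne_one this
    obtain ⟨u, hu⟩ := ((isUnit_or_isNilpotent_of_forall_isIdempotentElem (K := K) hR
      (y * x)).resolve_left hyx).isUnit_one_add
    refine ⟨↑u⁻¹, ?_⟩
    rw [Ideal.mem_bot, sub_eq_zero]
    calc (↑u⁻¹ * y * x + ↑u⁻¹ : R) = ↑u⁻¹ * (1 + y * x) := by noncomm_ring
      _ = 1 := by rw [← hu, Units.inv_mul]
  have hne : Ring.jacobson R ≠ ⊤ := by
    rw [← Ideal.jacobson_bot, Ne, Ideal.jacobson_eq_top_iff]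
    exact bot_ne_top
  have : Nontrivial (R ⧸ Ring.jacobson R) := Ideal.Quotient.nontrivial_iff.2 hne
  have : NoZeroDivisors (R ⧸ Ring.jacobson R) := ⟨fun {a b} hab => by
    obtain ⟨a, rfl⟩ := Ideal.Quotient.mk_surjective a
    obtain ⟨b, rfl⟩ := Ideal.Quotient.mk_surjective b
    rw [← map_mul, Ideal.Quotient.eq_zero_iff_mem] at hab
    rw [Ideal.Quotient.eq_zero_iff_mem, Ideal.Quotient.eq_zero_iff_mem]
    obtain ⟨u, rfl⟩ | ha := hx a
    · right
      simpa using Ideal.mul_mem_left _ (↑u⁻¹) hab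
    · exact .inl ha⟩
  have : IsDomain (R ⧸ Ring.jacobson R) := NoZeroDivisors.to_isDomain _
  have : Module.Finite K (R ⧸ Ring.jacobson R) :=
    Module.Finite.of_surjective (Ideal.Quotient.mkₐ K (Ring.jacobson R)).toLinearMap
      Ideal.Quotient.mk_surjective
  -- The quotient by the radical is a domain finite over an algebraically closed field, hence equal
  -- to `K`.
  let ε : K ≃ₐ[K] R ⧸ Ring.jacobson R :=
    AlgEquiv.ofBijective (Algebra.ofId K _) IsAlgClosed.algebraMap_bijective_of_isIntegral
  have : IsArtinianRing R := IsArtinianRing.of_finite K R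
  refine ⟨ε.symm.toAlgHom.comp (Ideal.Quotient.mkₐ K (Ring.jacobson R)), ?_⟩
  convert IsSemiprimaryRing.isNilpotent (R := R)
  ext x
  rw [RingHom.mem_ker, ← Ideal.Quotient.eq_zero_iff_mem]
  change ε.symm _ = 0 ↔ _
  rw [EmbeddingLike.map_eq_zero_iff]
  rfl

end LocalAlgebra

/-! ### Corner algebras -/

namespace IsIdempotentElem

variable {K R : Type*} [Field K] [Ring R] [Algebra K R] {e : R} (he : IsIdempotentElem e)

lemma Corner.mul_val (x : he.Corner) : e * x.1 = x.1 :=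
  ((Subsemigroup.mem_corner_iff he).1 x.2).1

lemma Corner.val_mul (x : he.Corner) : x.1 * e = x.1 :=
  ((Subsemigroup.mem_corner_iff he).1 x.2).2

/-- The element `e * x * e` of the corner ring. -/
def toCorner (x : R) : he.Corner := ⟨e * x * e, x, rfl⟩

instance : Algebra K he.Corner :=
  RingHom.toAlgebra'
    { toFun := fun c => ⟨c • e, c • 1, by simp [he.eq]⟩
      map_zero' := Subtype.ext (zero_smul K e)
      map_one' := Subtype.ext (one_smul K e)
      map_add' := fun a b => Subtype.ext (add_smul a b e)
      map_mul' := fun a b => Subtype.ext (by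
        change (a * b) • e = (a • e) * (b • e)
        rw [smul_mul_smul_comm, he.eq]) }
    fun c x => Subtype.ext (by
      change (c • e) * x.1 = x.1 * (c • e)
      rw [smul_mul_assoc, mul_smul_comm, Corner.mul_val, Corner.val_mul])

lemma Corner.smul_val (c : K) (x : he.Corner) : (c • x).1 = c • x.1 := by
  change (c • e) * x.1 = c • x.1
  rw [smul_mul_assoc, Corner.mul_val]

variable (K) in
/-- The inclusion of the corner ring. -/
def cornerVal : he.Corner →ₗ[K] R where
  toFun x := x.1
  map_add' _ _ := rfl
  map_smul' := Corner.smul_val he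

variable (K) in
/-- The projection to the corner ring. -/
def cornerProj : R →ₗ[K] he.Corner where
  toFun := he.toCorner
  map_add' x y := Subtype.ext (by
    change e * (x + y) * e = e * x * e + e * y * e
    rw [mul_add, add_mul])
  map_smul' c x := Subtype.ext (by
    rw [RingHom.id_apply, Corner.smul_val]
    change e * (c • x) * e = c • (e * x * e)
    rw [mul_smul_comm, smul_mul_assoc])

/-- Compression to the corner is not multiplicative, but becomes so with `e` inserted between the
factors. -/
lemma cornerProj_mul_mul (x y : R) :
    he.cornerProj K (x * e * y) = he.cornerProj K x * he.cornerProj K y :=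
  Subtype.ext (by
    change e * (x * e * y) * e = (e * x * e) * (e * y * e)
    simp only [mul_assoc]
    rw [he.mul_self_mul])

instance [FiniteDimensional K R] : FiniteDimensional K he.Corner :=
  FiniteDimensional.of_injective (he.cornerVal K) Subtype.val_injective

end IsIdempotentElem

/-! ### Primitive idempotents in tensor products -/

namespace IsPrimitiveIdempotent

variable {K Λ : Type*} [Field K] [Ring Λ] [Algebra K Λ] {e : Λ}

/-- The idempotents `f` and `e - f` decompose `e` orthogonally. With the converse below, primitivity
becomes a condition on the corner. -/
lemma eq_zero_or_eq (he : IsPrimitiveIdempotent e) {f : Λ} (hf : IsIdempotentElem f)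
    (h₁ : e * f = f) (h₂ : f * e = f) : f = 0 ∨ f = e := by
  have h₃ : f * (e - f) = 0 := by rw [mul_sub, h₂, hf.eq, sub_self]
  have h₄ : (e - f) * f = 0 := by rw [sub_mul, h₁, hf.eq, sub_self]
  refine (he.eq_zero_or_eq_zero f (e - f) hf ?_ h₃ h₄ (by abel)).imp_right
    fun h => (sub_eq_zero.1 h).symm
  rw [IsIdempotentElem, sub_mul, h₃, sub_zero, mul_sub, he.idem.eq, h₁]

lemma of_forall_eq_zero_or_eq (he : IsIdempotentElem e) (h0 : e ≠ 0)
    (h : ∀ f, IsIdempotentElem f → e * f = f → f * e = f → f = 0 ∨ f = e) :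
    IsPrimitiveIdempotent e where
  idem := he
  ne_zero := h0
  eq_zero_or_eq_zero f g hf hg hfg hgf hefg := by
    refine (h f hf ?_ ?_).imp_right fun hfe => ?_
    · rw [hefg, add_mul, hf.eq, hgf, add_zero]
    · rw [hefg, mul_add, hf.eq, hfg, add_zero]
    · rw [hfe] at hefg
      simpa using hefg

lemma nontrivial_corner (he : IsPrimitiveIdempotent e) : Nontrivial he.idem.Corner :=
  ⟨0, 1, fun h => he.ne_zero (congrArg Subtype.val h).symm⟩

lemma exists_algHom_corner [FiniteDimensional K Λ] [IsAlgClosed K] (he : IsPrimitiveIdempotent e) :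
    ∃ π : he.idem.Corner →ₐ[K] K, IsNilpotent (RingHom.ker π) := by
  have := he.nontrivial_corner
  refine exists_algHom_isNilpotent_ker fun f hf => ?_
  exact (he.eq_zero_or_eq (congrArg Subtype.val hf.eq) (IsIdempotentElem.Corner.mul_val _ f)
    (IsIdempotentElem.Corner.val_mul _ f)).imp Subtype.ext Subtype.ext

/-- If `e` is a primitive idempotent, then so is `e' ⊗ e` for every primitive idempotent `e'`,
over an algebraically closed field. -/
theorem tmul {Γ : Type*} [Ring Γ] [Algebra K Γ] [FiniteDimensional K Λ] [IsAlgClosed K] {d : Γ}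
    (hd : IsPrimitiveIdempotent d) (he : IsPrimitiveIdempotent e) :
    IsPrimitiveIdempotent (d ⊗ₜ[K] e) := by
  obtain ⟨π, n, hπ⟩ := he.exists_algHom_corner (K := K)
  let φ : Λ →ₗ[K] K := π.toLinearMap ∘ₗ he.idem.cornerProj K
  have hφ (x y : Λ) : φ (x * e * y) = φ x * φ y := by
    simp [φ, he.idem.cornerProj_mul_mul]
  have hφe : φ e = 1 := by
    have : he.idem.cornerProj K e = 1 := Subtype.ext (by
      change e * e * e = e
      rw [he.idem.eq, he.idem.eq])
    simp [φ, this]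
  -- By `hψ` below, `ψ` is multiplicative on the corner of `d ⊗ e`, where `d ⊗ e` acts as the
  -- identity.
  let ψ : Γ ⊗[K] Λ →ₗ[K] Γ := (TensorProduct.rid K Γ).toLinearMap ∘ₗ LinearMap.lTensor Γ φ
  have hψt (x : Γ) (y : Λ) : ψ (x ⊗ₜ y) = φ y • x := by simp [ψ]
  have hψ (a b : Γ ⊗[K] Λ) : ψ (a * (d ⊗ₜ e) * b) = ψ a * d * ψ b := by
    induction a with
    | zero => simp
    | add a a' h h' => simp only [add_mul, map_add, h, h']
    | tmul x y =>
      induction b with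
      | zero => simp
      | add b b' h h' => simp only [mul_add, map_add, h, h']
      | tmul x' y' =>
        simp only [Algebra.TensorProduct.tmul_mul_tmul, hψt, hφ, smul_mul_assoc, mul_smul_comm,
          smul_smul]
        rw [mul_comm]
  have hψe : ψ (d ⊗ₜ e) = d := by rw [hψt, hφe, one_smul]
  have hE : IsIdempotentElem (d ⊗ₜ[K] e) := by
    rw [IsIdempotentElem, Algebra.TensorProduct.tmul_mul_tmul, hd.idem.eq, he.idem.eq]
  -- Powers of the radical of `eΛe` induce the subspaces `T k`, the images of `Γ ⊗ J k`, with `T k *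
  -- T 1 ⊆ T (k + 1)` and `T (n + 1) = 0`.
  let J (k : ℕ) : Ideal he.idem.Corner := RingHom.ker π ^ k
  have hJ₁ : J 1 = RingHom.ker π := Submodule.pow_one _
  have hJ (k : ℕ) : J (k + 1) = J k * J 1 := by
    rw [hJ₁]
    exact Submodule.pow_succ ..
  let N (k : ℕ) : Submodule K Λ := ((J k).restrictScalars K).map (he.idem.cornerVal K)
  let T (k : ℕ) : Submodule K (Γ ⊗[K] Λ) := Submodule.map₂ (TensorProduct.mk K Γ Λ) ⊤ (N k)
  have hT {k : ℕ} {s t : Γ ⊗[K] Λ} (hs : s ∈ T k) (ht : t ∈ T 1) : s * t ∈ T (k + 1) := by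
    have h₁ : T k ≤ (T (k + 1)).comap (LinearMap.mulRight K t) :=
      Submodule.map₂_le.2 fun x _ y hy => by
        have h₂ : T 1 ≤ (T (k + 1)).comap (LinearMap.mulLeft K (x ⊗ₜ y)) :=
          Submodule.map₂_le.2 fun x' _ y' hy' => by
            obtain ⟨y, hy, rfl⟩ := hy
            obtain ⟨y', hy', rfl⟩ := hy'
            change x ⊗ₜ[K] y.1 * x' ⊗ₜ[K] y'.1 ∈ T (k + 1)
            rw [Algebra.TensorProduct.tmul_mul_tmul]
            exact Submodule.apply_mem_map₂ (TensorProduct.mk K Γ Λ) (m := x * x') Submodule.mem_top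
              (show y.1 * y'.1 ∈ N (k + 1) from
                ⟨y * y', hJ k ▸ Ideal.mul_mem_mul hy hy', rfl⟩)
        exact h₂ ht
    exact h₁ hs
  -- Since `e * y * e - φ y • e` lies in the radical, a corner element is determined by `ψ` modulo
  -- `T 1`.
  have hred (z : Γ ⊗[K] Λ) : d ⊗ₜ e * z * d ⊗ₜ e - (d * ψ z * d) ⊗ₜ e ∈ T 1 := by
    induction z with
    | zero => simp
    | add z z' h h' =>
      convert add_mem h h' using 1
      simp only [mul_add, add_mul, map_add, TensorProduct.add_tmul]
      abel
    | tmul x y =>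
      rw [Algebra.TensorProduct.tmul_mul_tmul, Algebra.TensorProduct.tmul_mul_tmul, hψt,
        mul_smul_comm, smul_mul_assoc, TensorProduct.smul_tmul, ← TensorProduct.tmul_sub]
      refine Submodule.apply_mem_map₂ _ Submodule.mem_top
        ⟨he.idem.cornerProj K y - φ y • 1, ?_, ?_⟩
      · change _ ∈ J 1
        rw [hJ₁]
        exact (by simp [φ] : π (he.idem.cornerProj K y - φ y • 1) = 0)
      · rw [map_sub, map_smul]
        rfl
  -- Such an `f` lies in `T 1`; being equal to all its positive powers, it lies in every `T (k +
  -- 1)`, hence vanishes.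
  have hz (f : Γ ⊗[K] Λ) (hf : IsIdempotentElem f) (h₁ : d ⊗ₜ e * f = f) (h₂ : f * d ⊗ₜ e = f)
      (h : ψ f = 0) : f = 0 := by
    have hf₁ : f ∈ T 1 := by
      simpa [h, h₁, h₂] using hred f
    have hfk (k : ℕ) : f ∈ T (k + 1) := by
      induction k with
      | zero => exact hf₁
      | succ k ih => exact hf.eq ▸ hT ih hf₁
    have hN : N (n + 1) = ⊥ := by
      have : J (n + 1) = ⊥ := by
        rw [hJ, show J n = 0 from hπ, zero_mul, Submodule.zero_eq_bot]
      simp only [N]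
      rw [this, Submodule.restrictScalars_bot, Submodule.map_bot]
    simpa [T, hN] using hfk n
  refine of_forall_eq_zero_or_eq hE (fun h => hd.ne_zero ?_) fun f hf h₁ h₂ => ?_
  · rw [← hψe, h, map_zero]
  have hdf : d * ψ f = ψ f := by
    conv_rhs => rw [← h₁, ← hE.eq, hψ, hψe, hd.idem.eq]
  have hfd : ψ f * d = ψ f := by
    conv_rhs => rw [← h₂]
    conv_rhs => rw [← hE.eq, ← mul_assoc, hψ, hψe, mul_assoc, hd.idem.eq]
  have hψf : IsIdempotentElem (ψ f) := by
    have := hψ f f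
    rw [h₂, hf.eq, hfd] at this
    exact this.symm
  obtain h | h := hd.eq_zero_or_eq hψf hdf hfd
  · exact .inl (hz f hf h₁ h₂ h)
  -- When `ψ f = d`, the complement `d ⊗ e - f` is an idempotent killed by `ψ`.
  · refine .inr (sub_eq_zero.1 (hz (d ⊗ₜ e - f) ?_ ?_ ?_ ?_)).symm
    · rw [IsIdempotentElem, mul_sub, sub_mul, sub_mul, hE.eq, h₁, h₂, hf.eq, sub_self, sub_zero]
    · rw [mul_sub, hE.eq, h₁]
    · rw [sub_mul, hE.eq, h₂]
    · rw [map_sub, hψe, h, sub_self]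

end IsPrimitiveIdempotent

/-! ### The swap anti-involution of the enveloping algebra -/

section EnvelopingAlgebra

lemma IsPrimitiveIdempotent.op {R : Type*} [Ring R] {e : R} (he : IsPrimitiveIdempotent e) :
    IsPrimitiveIdempotent (MulOpposite.op e) :=
  of_forall_eq_zero_or_eq (congrArg MulOpposite.op he.idem.eq)
    (fun h => he.ne_zero (MulOpposite.op_injective h)) fun _ hf h₁ h₂ =>
    (he.eq_zero_or_eq (congrArg MulOpposite.unop hf.eq) (congrArg MulOpposite.unop h₂)
      (congrArg MulOpposite.unop h₁)).imp
      (fun h => MulOpposite.unop_injective h) (fun h => MulOpposite.unop_injective h)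

variable (K Λ : Type*) [Field K] [Ring Λ] [Algebra K Λ]

/-- The swap of the two factors of the enveloping algebra, an anti-automorphism. -/
def envelopingSwap : (Λᵐᵒᵖ ⊗[K] Λ) ≃ₗ[K] (Λᵐᵒᵖ ⊗[K] Λ) :=
  TensorProduct.comm K Λᵐᵒᵖ Λ ≪≫ₗ
    TensorProduct.congr (MulOpposite.opLinearEquiv K) (MulOpposite.opLinearEquiv K).symm

variable {Λ}

@[simp]
lemma envelopingSwap_tmul (a : Λᵐᵒᵖ) (b : Λ) :
    envelopingSwap K Λ (a ⊗ₜ b) = MulOpposite.op b ⊗ₜ a.unop :=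
  rfl

lemma envelopingSwap_mul (x y : Λᵐᵒᵖ ⊗[K] Λ) :
    envelopingSwap K Λ (x * y) = envelopingSwap K Λ y * envelopingSwap K Λ x := by
  induction x with
  | zero => simp
  | add x x' h h' => simp only [add_mul, mul_add, map_add, h, h']
  | tmul a b =>
    induction y with
    | zero => simp
    | add y y' h h' => simp only [add_mul, mul_add, map_add, h, h']
    | tmul a' b' => simp

lemma envelopingSwap_envelopingSwap (x : Λᵐᵒᵖ ⊗[K] Λ) :
    envelopingSwap K Λ (envelopingSwap K Λ x) = x := by
  induction x with
  | zero => simp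
  | add x x' h h' => simp only [map_add, h, h']
  | tmul a b => simp

variable (Λ) in
/-- `envelopingSwap` as a ring homomorphism from the opposite ring. -/
def envelopingSwapHom : (Λᵐᵒᵖ ⊗[K] Λ)ᵐᵒᵖ →+* Λᵐᵒᵖ ⊗[K] Λ where
  toFun x := envelopingSwap K Λ x.unop
  map_zero' := map_zero (envelopingSwap K Λ)
  map_one' := rfl
  map_add' x y := map_add (envelopingSwap K Λ) x.unop y.unop
  map_mul' x y := envelopingSwap_mul K y.unop x.unop

end EnvelopingAlgebra

end

theorem theorem2p1 {K : Type*} {Λ : Type*} [Field K] [IsAlgClosed K] [Ring Λ] [Algebra K Λ]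
    [FiniteDimensional K Λ] (e : Λ) (he : IsPrimitiveIdempotent e) :
    (∃ ς : (Λᵐᵒᵖ ⊗[K] Λ) ≃ₗ[K] (Λᵐᵒᵖ ⊗[K] Λ),
      (∀ x y, ς (x * y) = ς y * ς x) ∧
      (∀ a b : Λ, ς (MulOpposite.op a ⊗ₜ[K] b) = MulOpposite.op b ⊗ₜ[K] a) ∧
      ς (MulOpposite.op e ⊗ₜ[K] e) = MulOpposite.op e ⊗ₜ[K] e) ∧
    ∃ h : IsPrimitiveIdempotent (MulOpposite.op e ⊗ₜ[K] e : Λᵐᵒᵖ ⊗[K] Λ),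
      Nonempty (Silting.TMinus (Silting.regular (Λᵐᵒᵖ ⊗[K] Λ)) (Silting.idempotentProj h.idem) ≃o
        (Silting.TPlus (Silting.regular (Λᵐᵒᵖ ⊗[K] Λ)) (Silting.idempotentProj h.idem))ᵒᵈ) :=
  ⟨⟨envelopingSwap K Λ, envelopingSwap_mul K, fun _ _ => rfl, rfl⟩, he.op.tmul he,
    Silting.nonempty_tMinus_orderIso (envelopingSwapHom K Λ) (envelopingSwap_envelopingSwap K) _
      rfl⟩
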